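/- Let $d,n\ge 1$, $\alpha>0$ and $c_1,\dots,c_n>0$. Fourier transforms are normalised by $\widehat f(\xi)=\int_{\mathbb R^d} e^{-ix\cdot\xi}f(x)\,dx$. For a.e. $\xi\in\mathbb R^d$ let $P(\xi)$ be a real orthogonal $n\times n$ matrix, each of whose entries is a (positively) homogeneous function of $\xi$, let $D(\xi)=\mathrm{diag}(-c_i|\xi|^{2\alpha})_{1\le i\le n}$, and assume that the symbol $S(\xi)=P(\xi)^{-1}D(\xi)P(\xi)$ agrees a.e. with a function that is smooth on $\mathbb R^d\setminus\{0\}$, again denoted by $S$. Let $\mathcal L$ be the Fourier multiplier with symbol $S$. For a vector $U_0=(U_0^1,\dots,U_0^n)$ of tempered distributions modulo polynomials let $U(t)=e^{t\mathcal L}U_0$, $t>0$, be the solution of $\partial_tU=\mathcal LU$, $U|_{t=0}=U_0$, that is, $\widehat{U(t)}(\xi)=e^{tS(\xi)}\widehat{U_0}(\xi)$ on $\mathbb R^d\setminus\{0\}$. Let $\chi$ be a smooth radial non-increasing function on $\mathbb R^d$, compactly supported in $B(0,\frac43)$ and equal to $1$ on $B(0,\frac34)$; put $\varphi(\xi)=\chi(\xi/2)-\chi(\xi)$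 and $\dot\Delta_ju=\mathcal F^{-1}(\varphi(2^{-j}\cdot)\widehat u)$ for $j\in\mathbb Z$. The space $\dot B^s_{p,r}$ consists of the tempered distributions modulo polynomials with $\|u\|_{\dot B^s_{p,r}}=\big\|\{2^{js}\|\dot\Delta_ju\|_{L^p}\}_{j\in\mathbb Z}\big\|_{\ell^r}<\infty$; norms of vectors are sums of the norms of the components. The subset $\dot{\mathcal B}^s_{p,\infty}$ consists of those $f\in\dot B^s_{p,\infty}$ for which there are constants $c,M>0$ and integers $j_1,j_2,\dots$ with $j_k\to-\infty$, $|j_k-j_{k+1}|\le M$ and $2^{sj_k}\|\dot\Delta_{j_k}f\|_{L^p}\ge c$ for all $k$. Let $1\le p,r\le\infty$, let $\sigma_1<\sigma$ be real numbers, and let $U_0\in\dot B^{\sigma}_{p,r}$. Then: (1) There is a constant $C>0$ such that $$\|e^{t\mathcal L}U_0\|_{\dot B^\sigma_{p,r}}\le C(1+t)^{-\frac{\sigma-\sigma_1}{2\alpha}}\quad\text{for all }t>0$$ if and only if $U_0\in\dot B^{\sigma_1}_{p,\infty}$. (2) There are constants $c,C>0$ such that $$c\,(1+t)^{-\frac{\sigma-\sigma_1}{2\alpha}}\le\|e^{t\mathcal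 L}U_0\|_{\dot B^\sigma_{p,r}}\le C(1+t)^{-\frac{\sigma-\sigma_1}{2\alpha}}\quad\text{for all }t>0$$ if and only if $U_0\in\dot{\mathcal B}^{\sigma_1}_{p,\infty}$. -/

import Mathlib

open MeasureTheory Filter
open scoped ENNReal SchwartzMap FourierTransform ContDiff

noncomputable section

/-- The physical space `ℝ^d` with its Euclidean norm (also used for the frequency space). -/
abbrev Space (d : ℕ) : Type := EuclideanSpace ℝ (Fin d)

/-- Complex-valued tempered distributions on `ℝ^d`.  The elements of `𝓢'_h = 𝓢'/𝒫` (tempered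
distributions modulo polynomials) are handled through representatives: everything below
(dyadic blocks, Besov norms, multiplier relations) depends on `𝓕 u` only away from the origin,
hence only on the class of `u` modulo polynomials. -/
abbrev TDist (d : ℕ) : Type := 𝓢'(Space d, ℂ)

/-! ### Littlewood–Paley decomposition

Mathlib's Fourier transform has the kernel `exp (-2πi ⟨x, ξ⟩)`.  The frequency variable of the
convention `∫ exp (-i ⟨x, ξ⟩) f x dx`, in which `-Δ` has the symbol `|ξ|²`, is therefore `2π` times
that of Mathlib.  Symbols are written in the second convention, and evaluated at `(2π) • ξ`. -/

/-- `χ` is a smooth radial non-increasing function, compactly supported in the ball `B(0,4/3)` and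
equal to `1` on `B(0,3/4)`. -/
structure IsLPCutoff {d : ℕ} (χ : Space d → ℝ) : Prop where
  smooth : ContDiff ℝ ∞ χ
  radial_antitone : ∀ x y : Space d, ‖x‖ ≤ ‖y‖ → χ y ≤ χ x
  support : tsupport χ ⊆ Metric.ball 0 (4 / 3)
  eq_one : ∀ x ∈ Metric.ball (0 : Space d) (3 / 4), χ x = 1

/-- `φ(ξ) = χ(ξ/2) - χ(ξ)`, supported in the annulus `3/4 ≤ |ξ| ≤ 8/3`. -/
def annulusCutoff {d : ℕ} (χ : Space d → ℝ) (ξ : Space d) : ℝ :=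
  χ ((1 / 2 : ℝ) • ξ) - χ ξ

/-- The homogeneous dyadic block `Δ_j u = 𝓕⁻¹ (φ(2^{-j} ·) 𝓕 u)`. -/
def dyadicBlock {d : ℕ} (χ : Space d → ℝ) (j : ℤ) (u : TDist d) : TDist d :=
  TemperedDistribution.fourierMultiplierCLM ℂ
    (fun ξ ↦ (annulusCutoff χ ((2 : ℝ) ^ (-j) • ((2 * Real.pi) • ξ)) : ℂ)) u

/-- The `L^p` norm of a tempered distribution: the norm of the (unique) `L^p` function that
represents it, and `∞` if there is none. -/
def distLpNorm {d : ℕ} (p : ℝ≥0∞) [Fact (1 ≤ p)] (u : TDist d) : ℝ≥0∞ :=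
  ⨅ (f : Lp ℂ p (volume : Measure (Space d)))
    (_ : MeasureTheory.Lp.toTemperedDistribution f = u), ‖f‖ₑ

/-- `‖Δ_j u‖_{L^p} = ∑ i, ‖Δ_j u_i‖_{L^p}` for a vector `u` of tempered distributions. -/
def blockNorm {d n : ℕ} (χ : Space d → ℝ) (p : ℝ≥0∞) [Fact (1 ≤ p)]
    (u : Fin n → TDist d) (j : ℤ) : ℝ≥0∞ :=
  ∑ i, distLpNorm p (dyadicBlock χ j (u i))

/-- The `ℓ^r` norm of a sequence indexed by `ℤ`: `(∑ |a j|^r)^{1/r}`, and the supremum if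
`r = ∞`. -/
def ellNorm (r : ℝ≥0∞) (a : ℤ → ℝ≥0∞) : ℝ≥0∞ :=
  if r = ⊤ then ⨆ j, a j else (∑' j, a j ^ r.toReal) ^ (1 / r.toReal)

/-- The homogeneous Besov norm of a scalar distribution,
`‖u‖_{Ḃ^s_{p,r}} = ‖ (2^{js} ‖Δ_j u‖_{L^p})_j ‖_{ℓ^r(ℤ)}`. -/
def scalarBesovNorm {d : ℕ} (χ : Space d → ℝ) (s : ℝ) (p r : ℝ≥0∞) [Fact (1 ≤ p)]
    (u : TDist d) : ℝ≥0∞ :=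
  ellNorm r (fun j ↦ (2 : ℝ≥0∞) ^ ((j : ℝ) * s) * distLpNorm p (dyadicBlock χ j u))

/-- The homogeneous Besov norm of a vector: the sum of the norms of its components. -/
def besovNorm {d n : ℕ} (χ : Space d → ℝ) (s : ℝ) (p r : ℝ≥0∞) [Fact (1 ≤ p)]
    (u : Fin n → TDist d) : ℝ≥0∞ :=
  ∑ i, scalarBesovNorm χ s p r (u i)

/-- Membership in the homogeneous Besov space `Ḃ^s_{p,r}` (modulo polynomials). -/
def MemBesov {d n : ℕ} (χ : Space d → ℝ) (s : ℝ) (p r : ℝ≥0∞) [Fact (1 ≤ p)]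
    (u : Fin n → TDist d) : Prop :=
  besovNorm χ s p r u < ⊤

/-- The subset `𝓑̇^s_{p,∞}` of `Ḃ^s_{p,∞}`: there are `c, M > 0` and integers `j_k → -∞` with
`|j_k - j_{k+1}| ≤ M` and `2^{s j_k} ‖Δ_{j_k} u‖_{L^p} ≥ c`. -/
def MemBesovLower {d n : ℕ} (χ : Space d → ℝ) (s : ℝ) (p : ℝ≥0∞) [Fact (1 ≤ p)]
    (u : Fin n → TDist d) : Prop :=
  MemBesov χ s p ⊤ u ∧
    ∃ (c M : ℝ) (j : ℕ → ℤ), 0 < c ∧ 0 < M ∧ Tendsto j atTop atBot ∧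
      (∀ k, |(j k : ℝ) - (j (k + 1) : ℝ)| ≤ M) ∧
      ∀ k, ENNReal.ofReal c ≤ (2 : ℝ≥0∞) ^ (s * (j k : ℝ)) * blockNorm χ p u (j k)

/-! ### Diffusive systems -/

/-- `S` is the symbol of a diffusive system of order `2α` with coefficients `c_i > 0`:
`S(ξ) = P(ξ)⁻¹ D(ξ) P(ξ)` for a.e. `ξ`, where `D(ξ) = diag(-c_i |ξ|^{2α})` and `P(ξ)` is orthogonal
with (positively) homogeneous entries.  The symbol is smooth away from the origin, so that it acts
on distributions modulo polynomials; `P` itself need not be continuous. -/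
structure IsDiffusiveSymbol {d n : ℕ} (α : ℝ) (c : Fin n → ℝ)
    (P S : Space d → Matrix (Fin n) (Fin n) ℝ) : Prop where
  order_pos : 0 < α
  coeff_pos : ∀ i, 0 < c i
  orthogonal : ∀ᵐ ξ, P ξ ∈ Matrix.orthogonalGroup (Fin n) ℝ
  homogeneous : ∀ i k, ∃ κ : ℝ, ∀ᵐ ξ, ∀ l : ℝ, 0 < l → P (l • ξ) i k = l ^ κ * P ξ i k
  symbol_eq : ∀ᵐ ξ, S ξ =
    (P ξ)⁻¹ * Matrix.diagonal (fun i ↦ -c i * ‖ξ‖ ^ (2 * α)) * P ξ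
  smooth : ∀ i k, ContDiffOn ℝ ∞ (fun ξ ↦ S ξ i k) {0}ᶜ

/-- `𝓕 v = M 𝓕 u` on `ℝ^d ∖ {0}`, in the sense of distributions, for a matrix symbol `M` that is
smooth away from the origin: `⟨𝓕 v_i, θ⟩ = ∑ k, ⟨𝓕 u_k, M_{ik} θ⟩` for all test functions `θ` with
compact support in `ℝ^d ∖ {0}`; here `ψ k` is the test function `M_{ik} θ`.
A distribution whose Fourier transform is supported at the origin is a polynomial, so this
determines `v` modulo polynomials, and it depends on `u` modulo polynomials only. -/
def IsFourierMultiplier {d n : ℕ} (M : Space d → Matrix (Fin n) (Fin n) ℝ)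
    (u v : Fin n → TDist d) : Prop :=
  ∀ (i : Fin n) (θ : 𝓢(Space d, ℂ)) (ψ : Fin n → 𝓢(Space d, ℂ)),
    HasCompactSupport θ → (0 : Space d) ∉ tsupport θ →
    (∀ k ξ, ψ k ξ = ((M ((2 * Real.pi) • ξ) i k : ℝ) : ℂ) * θ ξ) →
    𝓕 (v i) θ = ∑ k, 𝓕 (u k) (ψ k)

/-- `U` is the solution `t ↦ e^{t𝓛} U₀`, `t > 0`, of `∂_t U = 𝓛 U`, `U(0) = U₀`, where `𝓛` is the
Fourier multiplier with symbol `S`: `𝓕 (U t) = e^{t S} 𝓕 U₀` away from the origin. -/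
def IsSemigroupSolution {d n : ℕ} (S : Space d → Matrix (Fin n) (Fin n) ℝ)
    (U₀ : Fin n → TDist d) (U : ℝ → Fin n → TDist d) : Prop :=
  ∀ t : ℝ, 0 < t → IsFourierMultiplier (fun ξ ↦ NormedSpace.exp (t • S ξ)) U₀ (U t)

end

/-!
The argument separates analysis, which takes place on a single dyadic block, from an elementary
statement about sequences indexed by `ℤ`.

*One dyadic block.* Orthogonality of `P(ξ)` forces its homogeneous entries to have degree `0`, so
`S` is homogeneous of degree `2α` (`IsDiffusiveSymbol.symbol_smul`). The eigenvalues
`-c_i|ξ|^{2α}` of `S(ξ)` have constant multiplicities, hence the spectral projections are Lagrange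
polynomials in `|ξ|^{-2α} S(ξ)`; they are smooth off the origin even if `P` is not continuous,
and `e^{tS}` is the sum of the scalar multipliers `e^{-tl|ξ|^{2α}}` times
these projections (`IsDiffusiveSymbol.exp_smul_symbol_apply`). Cut off to a fixed annulus, such a
multiplier has Schwartz seminorms, and therefore a convolution kernel in `L¹`, of size
`O(e^{-κt})` (`exists_kernelNorm_exp_le`); the homogeneity of `S` turns this into `O(e^{-κt2^{2αj}})` on the
annulus of size `2^j`. Young's inequality (`exists_Lp_fourierMultiplier`) then gives, for every
`p ∈ [1, ∞]`,
`‖Δ_j U(t)‖ ≤ C e^{-κt2^{2αj}} ‖Δ_j U₀‖`, and, since `e^{-tS}` inverts the semigroup with bounded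
kernels as long as `t2^{2αj} ≤ 1`, also `‖Δ_j U₀‖ ≤ C ‖Δ_j U(t)‖` for such `j`
(`IsDiffusiveSymbol.exists_blockNorm_le`).

*Sequences.* At time `t = 2^{-2αs}` the damped sequence is concentrated near the index `s`, with
tails decaying geometrically. If `2^{jσ₁}‖Δ_j U₀‖` is bounded, summation over `j` yields the decay
rate `t^{-(σ-σ₁)/(2α)} = 2^{(σ-σ₁)s}`. Conversely, the rate at time `2^{-2αj}` bounds the single
block `j`. For the lower bounds, a large block at an index within bounded distance of `s` suffices;
conversely, for `s = m` a non-positive integer the tails are negligible compared to the lower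
bound, so that some block within a fixed distance of `m` has to be large.
-/

noncomputable section

/-! ### Young's inequality and `L^p` bounds for Fourier multipliers -/

/-- Jensen's inequality for the (not normalised) weight `k`. -/
lemma lintegral_mul_rpow_le {X : Type*} [MeasurableSpace X] {μ : Measure X} {k g : X → ℝ≥0∞}
    (hk : AEMeasurable k μ) (hg : AEMeasurable g μ) (hkt : ∀ x, k x ≠ ⊤) {q : ℝ} (hq : 1 ≤ q) :
    (∫⁻ y, k y * g y ∂μ) ^ q ≤ (∫⁻ y, k y ∂μ) ^ (q - 1) * ∫⁻ y, k y * g y ^ q ∂μ := by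
  have hq0 : 0 < q := by linarith
  have h1 : ∀ y, k y * g y = k y ^ (1 - 1 / q) * (k y * g y ^ q) ^ (1 / q) := by
    intro y
    rw [ENNReal.mul_rpow_of_nonneg _ _ (by positivity), ← ENNReal.rpow_mul,
      mul_one_div_cancel hq0.ne', ENNReal.rpow_one, ← mul_assoc]
    rcases eq_or_ne (k y) 0 with h0 | h0
    · simp [h0, hq0]
    · rw [← ENNReal.rpow_add _ _ h0 (hkt y)]
      simp
  have h2 := ENNReal.lintegral_mul_norm_pow_le hk (hk.mul (hg.pow_const q))
    (p := 1 - 1 / q) (q := 1 / q) (by rw [sub_nonneg, div_le_one hq0]; exact hq) (by positivity)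
    (by ring)
  simp_rw [Pi.mul_apply, ← h1] at h2
  calc _ ≤ ((∫⁻ y, k y ∂μ) ^ (1 - 1 / q) * (∫⁻ y, k y * g y ^ q ∂μ) ^ (1 / q)) ^ q := by gcongr
    _ = _ := by
      rw [ENNReal.mul_rpow_of_nonneg _ _ hq0.le, ← ENNReal.rpow_mul, ← ENNReal.rpow_mul,
        one_div_mul_cancel hq0.ne', ENNReal.rpow_one]
      congr 2
      field_simp

section Young

variable {E : Type*} [NormedAddCommGroup E] [InnerProductSpace ℝ E] [FiniteDimensional ℝ E]
  [MeasurableSpace E] [BorelSpace E]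

/-- Young's inequality `L¹ * L^p ⊆ L^p` for non-negative functions. -/
lemma eLpNorm_lintegral_translate_le {k g : E → ℝ≥0∞} (hk : Measurable k) (hg : Measurable g)
    (hkt : ∀ x, k x ≠ ⊤) {p : ℝ≥0∞} (hp : 1 ≤ p) :
    eLpNorm (fun x ↦ ∫⁻ y, k y * g (x + y)) p volume ≤ (∫⁻ y, k y) * eLpNorm g p volume := by
  have hp0 : p ≠ 0 := (one_pos.trans_le hp).ne'
  rcases eq_or_ne p ⊤ with rfl | hpt
  · rw [eLpNorm_exponent_top, eLpNorm_exponent_top]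
    refine essSup_le_of_ae_le _ (ae_of_all _ fun x ↦ ?_)
    rw [← lintegral_mul_const _ hk]
    refine lintegral_mono_ae ?_
    have h := (measurePreserving_add_left (volume : Measure E) x).quasiMeasurePreserving.ae
      (enorm_ae_le_eLpNormEssSup g volume)
    filter_upwards [h] with y hy
    gcongr
    exact hy
  · have hq : 1 ≤ p.toReal := by
      rw [← ENNReal.toReal_one]; exact ENNReal.toReal_mono hpt hp
    have hq0 : 0 < p.toReal := by linarith
    rw [eLpNorm_eq_lintegral_rpow_enorm_toReal hp0 hpt,
      eLpNorm_eq_lintegral_rpow_enorm_toReal hp0 hpt]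
    simp only [enorm_eq_self]
    set q := p.toReal
    have hgq : Measurable fun x ↦ g x ^ q := hg.pow_const q
    have main : ∫⁻ x, (∫⁻ y, k y * g (x + y)) ^ q ≤ (∫⁻ y, k y) ^ q * ∫⁻ x, g x ^ q := by
      calc _ ≤ ∫⁻ x, (∫⁻ y, k y) ^ (q - 1) * ∫⁻ y, k y * g (x + y) ^ q := by
            refine lintegral_mono fun x ↦ ?_
            exact lintegral_mul_rpow_le hk.aemeasurable
              (hg.comp (measurable_const_add x)).aemeasurable hkt hq
        _ = (∫⁻ y, k y) ^ (q - 1) * ∫⁻ x, ∫⁻ y, k y * g (x + y) ^ q := by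
            rw [lintegral_const_mul]
            exact Measurable.lintegral_prod_right' (f := fun z : E × E ↦ k z.2 * g (z.1 + z.2) ^ q)
              (by fun_prop)
        _ = (∫⁻ y, k y) ^ (q - 1) * ∫⁻ y, ∫⁻ x, k y * g (x + y) ^ q := by
            rw [lintegral_lintegral_swap]
            fun_prop
        _ = (∫⁻ y, k y) ^ (q - 1) * ((∫⁻ y, k y) * ∫⁻ x, g x ^ q) := by
            congr 1
            rw [← lintegral_mul_const _ hk]
            refine lintegral_congr fun y ↦ ?_
            rw [lintegral_const_mul _ (by fun_prop),
              lintegral_add_right_eq_self (fun x ↦ g x ^ q) y]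
        _ = _ := by
            rw [← mul_assoc]
            congr 1
            rcases eq_or_ne (∫⁻ y, k y) 0 with h0 | h0
            · simp [h0, hq0]
            rcases eq_or_ne (∫⁻ y, k y) ⊤ with ht | ht
            · rw [ht, ENNReal.top_rpow_of_pos hq0, ENNReal.mul_top]
              rcases hq.eq_or_lt with h1 | h1
              · simp [← h1]
              · simp [ENNReal.top_rpow_of_pos (sub_pos.2 h1)]
            · nth_rewrite 2 [← ENNReal.rpow_one (∫⁻ y, k y)]
              rw [← ENNReal.rpow_add _ _ h0 ht]
              simp
    calc _ ≤ ((∫⁻ y, k y) ^ q * ∫⁻ x, g x ^ q) ^ (1 / q) := by gcongr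
      _ = _ := by
        rw [ENNReal.mul_rpow_of_nonneg _ _ (by positivity), ← ENNReal.rpow_mul,
          mul_one_div_cancel hq0.ne', ENNReal.rpow_one]

/-- The `L¹` norm of the convolution kernel of the Fourier multiplier with symbol `m`. The
reflection that distinguishes `𝓕 m` from the kernel `𝓕⁻ m` does not affect the norm. -/
def kernelNorm (m : E → ℂ) : ℝ≥0∞ := ∫⁻ x, ‖𝓕 m x‖ₑ

/-- On test functions, the transpose of a Fourier multiplier is a convolution. -/
lemma fourier_smul_fourierInv_eq_integral (m g : 𝓢(E, ℂ)) (x : E) :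
    𝓕 (SchwartzMap.smulLeftCLM ℂ m (𝓕⁻ g)) x = ∫ y, 𝓕 m y * g (x - y) := by
  have h1 : (SchwartzMap.smulLeftCLM ℂ m (𝓕⁻ g))
      = 𝓕⁻ (SchwartzMap.convolution (ContinuousLinearMap.mul ℂ ℂ) (𝓕 m) g) := by
    ext ξ
    rw [SchwartzMap.smulLeftCLM_apply_apply m.hasTemperateGrowth, SchwartzMap.fourierInv_coe,
      SchwartzMap.fourierInv_coe, Real.fourierInv_eq_fourier_neg, Real.fourierInv_eq_fourier_neg,
      ← SchwartzMap.fourier_coe, ← SchwartzMap.fourier_coe, SchwartzMap.fourier_convolution_apply,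
      Real.fourier_mul_convolution_eq (𝓕 m).integrable g.integrable,
      ← SchwartzMap.fourier_coe (𝓕 m), ← SchwartzMap.fourier_coe]
    have h2 : 𝓕 (𝓕 m) (-ξ) = m ξ := by
      rw [SchwartzMap.fourier_coe (𝓕 m), ← Real.fourierInv_eq_fourier_neg,
        ← SchwartzMap.fourierInv_coe, FourierTransform.fourierInv_fourier_eq]
    rw [h2, smul_eq_mul]
  rw [h1, FourierTransform.fourier_fourierInv_eq, SchwartzMap.convolution_apply]
  rfl

lemma kernelNorm_ne_top (m : 𝓢(E, ℂ)) : kernelNorm m ≠ ⊤ :=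
  ((hasFiniteIntegral_iff_enorm.1 (𝓕 m).integrable.2)).ne

/-- Fourier multipliers with Schwartz symbols act on `L^p` by convolution with an integrable
kernel, hence boundedly. -/
lemma exists_Lp_fourierMultiplier (m : 𝓢(E, ℂ)) {p : ℝ≥0∞} [hp : Fact (1 ≤ p)]
    (f : Lp ℂ p (volume : Measure E)) :
    ∃ h : Lp ℂ p (volume : Measure E), Lp.toTemperedDistribution h =
      TemperedDistribution.fourierMultiplierCLM ℂ m (Lp.toTemperedDistribution f) ∧
      ‖h‖ₑ ≤ kernelNorm m * ‖f‖ₑ := by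
  set L : 𝓢(E, ℂ) := 𝓕 m with hL
  have hfm : StronglyMeasurable f := Lp.stronglyMeasurable f
  have hfe : Measurable fun x ↦ ‖f x‖ₑ := hfm.enorm
  have hLe : Measurable fun x ↦ ‖L x‖ₑ := L.continuous.enorm.measurable
  have hadd : Measurable fun z : E × E ↦ z.1 + z.2 := measurable_fst.add measurable_snd
  let F : E → ℂ := fun x ↦ ∫ y, L y * f (x + y)
  let G : E → ℝ≥0∞ := fun x ↦ ∫⁻ y, ‖L y‖ₑ * ‖f (x + y)‖ₑ
  have hF : StronglyMeasurable F := by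
    refine StronglyMeasurable.integral_prod_right' (f := fun z : E × E ↦ L z.2 * f (z.1 + z.2)) ?_
    exact (L.continuous.comp continuous_snd).stronglyMeasurable.mul (hfm.comp_measurable hadd)
  have hG : Measurable G :=
    Measurable.lintegral_prod_right' (f := fun z : E × E ↦ ‖L z.2‖ₑ * ‖f (z.1 + z.2)‖ₑ)
      ((hLe.comp measurable_snd).mul (hfe.comp hadd))
  have hFG : ∀ x, ‖F x‖ₑ ≤ G x := fun x ↦ by
    refine (enorm_integral_le_lintegral_enorm _).trans_eq ?_
    simp only [enorm_mul, G]
  have hGp : eLpNorm G p volume ≤ kernelNorm m * ‖f‖ₑ := by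
    refine (eLpNorm_lintegral_translate_le hLe hfe (fun x ↦ enorm_ne_top) hp.out).trans_eq ?_
    rw [eLpNorm_enorm, Lp.enorm_def]
    rfl
  have hfin : kernelNorm m * ‖f‖ₑ < ⊤ :=
    ENNReal.mul_lt_top (kernelNorm_ne_top m).lt_top enorm_lt_top
  have hFp : eLpNorm F p volume ≤ kernelNorm m * ‖f‖ₑ :=
    (eLpNorm_mono_enorm fun x ↦ by simpa using hFG x).trans hGp
  have hFm : MemLp F p volume := ⟨hF.aestronglyMeasurable, hFp.trans_lt hfin⟩
  refine ⟨hFm.toLp F, ?_, by rwa [Lp.enorm_toLp]⟩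
  ext g
  rw [Lp.toTemperedDistribution_apply, TemperedDistribution.fourierMultiplierCLM_apply_apply,
    Lp.toTemperedDistribution_apply]
  simp_rw [fourier_smul_fourierInv_eq_integral, ← hL, smul_eq_mul]
  -- The integrand of the double integral, in coordinates adapted to `F`.
  have hint : Integrable (fun z : E × E ↦ g z.1 * (L z.2 * f (z.1 + z.2)))
      (volume.prod volume) := by
    have hms : StronglyMeasurable (fun z : E × E ↦ g z.1 * (L z.2 * f (z.1 + z.2))) :=
      (g.continuous.comp continuous_fst).stronglyMeasurable.mul
        ((L.continuous.comp continuous_snd).stronglyMeasurable.mul (hfm.comp_measurable hadd))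
    refine ⟨hms.aestronglyMeasurable, ?_⟩
    rw [hasFiniteIntegral_iff_enorm, lintegral_prod _ hms.enorm.aemeasurable]
    simp only [enorm_mul]
    have h1 : ∀ x, ∫⁻ y, ‖g x‖ₑ * (‖L y‖ₑ * ‖f (x + y)‖ₑ) = ‖g x‖ₑ * G x := fun x ↦
      lintegral_const_mul _ (hLe.mul (hfe.comp (measurable_const_add x)))
    simp_rw [h1]
    have := ENNReal.HolderConjugate.inv_one_sub_inv' hp.out
    have hGt : ∀ x, G x ≠ ⊤ := fun x ↦ by
      have h2 : MemLp (fun y ↦ f (x + y)) p volume :=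
        (Lp.memLp f).comp_measurePreserving (measurePreserving_add_left volume x)
      have h3 := (hasFiniteIntegral_iff_enorm.1 (h2.integrable_mul (L.memLp (1 - p⁻¹)⁻¹)).2).ne
      simpa only [G, Pi.mul_apply, enorm_mul, mul_comm] using h3
    have hGm : MemLp (fun x ↦ (G x).toReal) p volume := by
      refine ⟨hG.ennreal_toReal.aestronglyMeasurable, (hGp.trans_lt hfin).trans_le' ?_⟩
      refine eLpNorm_mono_enorm fun x ↦ ?_
      rw [Real.enorm_of_nonneg ENNReal.toReal_nonneg, ENNReal.ofReal_toReal (hGt x), enorm_eq_self]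
    have h4 := hasFiniteIntegral_iff_enorm.1
      (hGm.integrable_mul (g.memLp (1 - p⁻¹)⁻¹).norm).2
    simpa only [Pi.mul_apply, enorm_mul, Real.enorm_of_nonneg ENNReal.toReal_nonneg,
      ENNReal.ofReal_toReal (hGt _), enorm_norm, mul_comm] using h4
  have hint' : Integrable (fun z : E × E ↦ g (z.1 - z.2) * (L z.2 * f z.1))
      (volume.prod volume) := by
    have h := (measurePreserving_sub_prod (volume : Measure E) volume)
      |>.integrable_comp_of_integrable hint
    refine h.congr (ae_of_all _ fun z ↦ ?_)
    simp
  calc ∫ x, g x * (hFm.toLp F) x = ∫ x, g x * F x :=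
        integral_congr_ae (by filter_upwards [hFm.coeFn_toLp] with x hx; rw [hx])
    _ = ∫ x, ∫ y, g x * (L y * f (x + y)) := by simp_rw [F, integral_const_mul]
    _ = ∫ y, ∫ x, g x * (L y * f (x + y)) := integral_integral_swap hint
    _ = ∫ y, ∫ x, g (x - y) * (L y * f x) := by
        refine integral_congr_ae (ae_of_all _ fun y ↦ ?_)
        simpa using integral_add_right_eq_self (μ := (volume : Measure E))
          (fun x ↦ g (x - y) * (L y * f x)) y
    _ = ∫ x, ∫ y, g (x - y) * (L y * f x) := (integral_integral_swap hint').symm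
    _ = ∫ x, (∫ y, L y * g (x - y)) * f x := by
        refine integral_congr_ae (ae_of_all _ fun x ↦ ?_)
        simp only
        rw [← integral_mul_const]
        exact integral_congr_ae (ae_of_all _ fun y ↦ by ring)

end Young

/-- Transfer of `L^p` bounds to `distLpNorm`. The cases `K = 0` and `K = ∞` are excluded because of
`0 * ∞ = 0`. -/
lemma distLpNorm_le_mul_of_forall {d : ℕ} {p : ℝ≥0∞} [Fact (1 ≤ p)] {u v : TDist d} {K : ℝ≥0∞}
    (hK0 : K ≠ 0) (hKt : K ≠ ⊤)
    (h : ∀ f : Lp ℂ p (volume : Measure (Space d)), Lp.toTemperedDistribution f = u →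
      ∃ g : Lp ℂ p (volume : Measure (Space d)), Lp.toTemperedDistribution g = v ∧
        ‖g‖ₑ ≤ K * ‖f‖ₑ) : distLpNorm p v ≤ K * distLpNorm p u := by
  unfold distLpNorm
  rw [ENNReal.mul_iInf_of_ne hK0 hKt]
  refine le_iInf fun f ↦ ?_
  rw [ENNReal.mul_iInf_of_ne hK0 hKt]
  refine le_iInf fun hf ↦ ?_
  obtain ⟨g, hg, hgf⟩ := h f hf
  exact (iInf₂_le g hg).trans hgf

lemma distLpNorm_fourierMultiplierCLM_le {d : ℕ} {p : ℝ≥0∞} [Fact (1 ≤ p)] (u : TDist d)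
    (m : 𝓢(Space d, ℂ)) {K : ℝ≥0∞} (hK0 : K ≠ 0) (hKt : K ≠ ⊤) (hK : kernelNorm m ≤ K) :
    distLpNorm p (TemperedDistribution.fourierMultiplierCLM ℂ m u) ≤ K * distLpNorm p u := by
  refine distLpNorm_le_mul_of_forall hK0 hKt fun f hf ↦ ?_
  obtain ⟨g, hg, hgf⟩ := exists_Lp_fourierMultiplier m f
  exact ⟨g, by rw [hg, hf], hgf.trans (by gcongr)⟩

lemma distLpNorm_zero {d : ℕ} {p : ℝ≥0∞} [Fact (1 ≤ p)] : distLpNorm p (0 : TDist d) = 0 := by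
  refine le_antisymm ((iInf₂_le (0 : Lp ℂ p (volume : Measure (Space d))) ?_).trans
    (by simp)) zero_le
  exact map_zero (Lp.toTemperedDistributionCLM ℂ volume p)

lemma distLpNorm_add_le {d : ℕ} {p : ℝ≥0∞} [Fact (1 ≤ p)] (u v : TDist d) :
    distLpNorm p (u + v) ≤ distLpNorm p u + distLpNorm p v := by
  unfold distLpNorm
  refine ENNReal.le_iInf_add_iInf fun f g ↦ ENNReal.le_iInf_add_iInf fun hf hg ↦ ?_
  refine (iInf₂_le (f + g) ?_).trans (enorm_add_le f g)
  rw [← hf, ← hg]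
  exact map_add (Lp.toTemperedDistributionCLM ℂ volume p) f g

lemma distLpNorm_sum_le {d : ℕ} {p : ℝ≥0∞} [Fact (1 ≤ p)] {ι : Type*} (s : Finset ι)
    (u : ι → TDist d) : distLpNorm p (∑ i ∈ s, u i) ≤ ∑ i ∈ s, distLpNorm p (u i) :=
  Finset.le_sum_of_subadditive _ distLpNorm_zero.le distLpNorm_add_le s u

/-- The norm of the kernel is invariant under dilations of the symbol. -/
lemma kernelNorm_comp_smul {E : Type*} [NormedAddCommGroup E] [InnerProductSpace ℝ E]
    [FiniteDimensional ℝ E] [MeasurableSpace E] [BorelSpace E] (m : E → ℂ) {a : ℝ} (ha : 0 < a) :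
    kernelNorm (fun ξ ↦ m (a • ξ)) = kernelNorm m := by
  have h1 : ∀ x, 𝓕 (fun ξ ↦ m (a • ξ)) x
      = ((a ^ Module.finrank ℝ E)⁻¹ : ℝ) • 𝓕 m (a⁻¹ • x) := fun x ↦ by
    rw [Real.fourier_eq, Real.fourier_eq]
    have := Measure.integral_comp_smul (volume : Measure E)
      (fun v ↦ Real.fourierChar (-inner ℝ v (a⁻¹ • x)) • m v) a
    rw [abs_of_pos (by positivity)] at this
    rw [← this]
    refine integral_congr_ae (ae_of_all _ fun v ↦ ?_)
    simp [inner_smul_left, inner_smul_right, ha.ne']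
  unfold kernelNorm
  simp_rw [h1, enorm_smul]
  rw [lintegral_const_mul' _ _ enorm_ne_top]
  have h2 : ∫⁻ x, ‖𝓕 m (a⁻¹ • x)‖ₑ
      = ∫⁻ x, ‖𝓕 m x‖ₑ ∂(Measure.map (a⁻¹ • ·) (volume : Measure E)) :=
    (lintegral_map_equiv (fun x ↦ ‖𝓕 m x‖ₑ)
      (Homeomorph.smulOfNeZero (α := E) a⁻¹ (inv_ne_zero ha.ne')).toMeasurableEquiv).symm
  rw [h2, Measure.map_addHaar_smul _ (inv_ne_zero ha.ne'), lintegral_smul_measure, smul_eq_mul,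
    ← mul_assoc, Real.enorm_of_nonneg (by positivity), ← ENNReal.ofReal_mul (by positivity),
    abs_of_pos (by positivity), inv_pow, inv_inv, inv_mul_cancel₀ (by positivity),
    ENNReal.ofReal_one, one_mul]

lemma exists_kernelNorm_le_seminorm (E : Type*) [NormedAddCommGroup E] [InnerProductSpace ℝ E]
    [FiniteDimensional ℝ E] [MeasurableSpace E] [BorelSpace E] :
    ∃ (s : Finset (ℕ × ℕ)) (C : NNReal), ∀ m : 𝓢(E, ℂ), kernelNorm m ≤
      ENNReal.ofReal (C * (s.sup (schwartzSeminormFamily ℂ E ℂ)) m) := by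
  let T : 𝓢(E, ℂ) →L[ℂ] Lp ℂ 1 (volume : Measure E) :=
    (SchwartzMap.toLpCLM ℂ ℂ 1 volume) ∘L (FourierTransform.fourierCLM ℂ 𝓢(E, ℂ))
  obtain ⟨s, C, -, h⟩ := Seminorm.bound_of_continuous (schwartz_withSeminorms ℂ E ℂ)
    ((normSeminorm ℂ (Lp ℂ 1 (volume : Measure E))).comp T.toLinearMap)
    (continuous_norm.comp T.continuous)
  refine ⟨s, C, fun m ↦ ?_⟩
  have h1 := h m
  have h2 : kernelNorm m = ‖T m‖ₑ := by
    rw [Lp.enorm_def, eLpNorm_one_eq_lintegral_enorm]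
    refine lintegral_congr_ae ?_
    filter_upwards [SchwartzMap.coeFn_toLp (𝓕 m) 1 (volume : Measure E)] with x hx
    exact congrArg _ hx.symm
  rw [h2, ← ofReal_norm]
  exact ENNReal.ofReal_le_ofReal h1

/-! ### Structure of diffusive symbols -/

lemma Matrix.aeval_inv_mul_diagonal_mul {n : ℕ} {P : Matrix (Fin n) (Fin n) ℝ} (hP : IsUnit P)
    (v : Fin n → ℝ) (q : Polynomial ℝ) :
    Polynomial.aeval (P⁻¹ * Matrix.diagonal v * P) q
      = P⁻¹ * Matrix.diagonal (fun i ↦ q.eval (v i)) * P := by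
  have hdet : IsUnit P.det := (Matrix.isUnit_iff_isUnit_det P).1 hP
  have h1 : P * P⁻¹ = 1 := Matrix.mul_nonsing_inv P hdet
  have h2 : P⁻¹ * P = 1 := Matrix.nonsing_inv_mul P hdet
  induction q using Polynomial.induction_on' with
  | add p q hp hq =>
    rw [map_add, hp, hq, ← add_mul, ← mul_add, Matrix.diagonal_add]
    simp
  | monomial k a =>
    have h3 : (P⁻¹ * Matrix.diagonal v * P) ^ k = P⁻¹ * Matrix.diagonal (v ^ k) * P := by
      induction k with
      | zero => simp [h2]
      | succ k ih =>
        rw [pow_succ, ih]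
        calc _ = P⁻¹ * Matrix.diagonal (v ^ k) * (P * P⁻¹) * Matrix.diagonal v * P := by
              simp only [mul_assoc]
          _ = _ := by
              rw [h1, mul_one, mul_assoc P⁻¹, Matrix.diagonal_mul_diagonal, pow_succ]
              rfl
    rw [Polynomial.aeval_monomial, h3, Algebra.algebraMap_eq_smul_one, smul_mul_assoc, one_mul,
      ← Matrix.smul_mul, ← Matrix.mul_smul, ← Matrix.diagonal_smul]
    congr 3
    ext i
    simp

lemma Matrix.smul_mul_diagonal_mul {n : ℕ} (a : ℝ) (A B : Matrix (Fin n) (Fin n) ℝ)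
    (v : Fin n → ℝ) :
    a • (A * Matrix.diagonal v * B) = A * Matrix.diagonal (fun i ↦ a * v i) * B := by
  rw [← Matrix.smul_mul, ← Matrix.mul_smul, ← Matrix.diagonal_smul]
  rfl

namespace IsDiffusiveSymbol

variable {d n : ℕ} {α : ℝ} {c : Fin n → ℝ} {P S : Space d → Matrix (Fin n) (Fin n) ℝ}

/-- Orthogonality bounds the entries of `P`, so that only degree `0` is possible for those that do
not vanish. -/
lemma ae_diagonalizer_smul (hS : IsDiffusiveSymbol α c P S) {a : ℝ} (ha : 0 < a) :
    ∀ᵐ ξ, P (a • ξ) = P ξ := by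
  have hpow : ∀ m : ℤ, ∀ᵐ ξ : Space d, P (a ^ m • ξ) ∈ Matrix.orthogonalGroup (Fin n) ℝ :=
    fun m ↦ (Measure.quasiMeasurePreserving_smul volume (zpow_ne_zero m ha.ne')).ae hS.orthogonal
  have hle : ∀ O ∈ Matrix.orthogonalGroup (Fin n) ℝ, ∀ i k, |O i k| ≤ 1 := fun O hO i k ↦ by
    simpa using entry_norm_bound_of_unitary hO i k
  choose κ hκ using hS.homogeneous
  have hκ' : ∀ᵐ ξ, ∀ i k, ∀ l : ℝ, 0 < l → P (l • ξ) i k = l ^ κ i k * P ξ i k :=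
    ae_all_iff.2 fun i ↦ ae_all_iff.2 fun k ↦ hκ i k
  filter_upwards [ae_all_iff.2 hpow, hκ'] with ξ h1 h2
  ext i k
  rw [h2 i k a ha]
  by_cases h0 : P ξ i k = 0
  · simp [h0]
  have hb : ∀ m : ℤ, (a ^ κ i k) ^ m * |P ξ i k| ≤ 1 := fun m ↦ by
    have h3 := hle _ (h1 m) i k
    rw [h2 i k _ (zpow_pos ha m), abs_mul, abs_of_pos (by positivity)] at h3
    rwa [← Real.rpow_intCast, ← Real.rpow_mul ha.le, mul_comm (κ i k), Real.rpow_mul ha.le,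
      Real.rpow_intCast]
  have hb0 : 0 < |P ξ i k| := abs_pos.2 h0
  -- All the powers `(a ^ κ) ^ m`, `m ∈ ℤ`, are bounded, hence `a ^ κ = 1`.
  have key : ∀ b : ℝ, (∀ m : ℕ, b ^ m * |P ξ i k| ≤ 1) → b ≤ 1 := fun b hb ↦ by
    by_contra! hlt
    obtain ⟨m, hm⟩ := pow_unbounded_of_one_lt (|P ξ i k|⁻¹) hlt
    have := hb m
    rw [← le_div_iff₀ hb0, one_div] at this
    linarith
  have h3 : a ^ κ i k ≤ 1 := key _ fun m ↦ by simpa using hb m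
  have h4 : (a ^ κ i k)⁻¹ ≤ 1 := key _ fun m ↦ by simpa using hb (-m)
  rw [le_antisymm h3 ((inv_le_one₀ (by positivity)).1 h4), one_mul]

lemma ae_ne_zero (hd : 1 ≤ d) : ∀ᵐ ξ : Space d, ξ ≠ 0 := by
  have : Nonempty (Fin d) := ⟨⟨0, hd⟩⟩
  exact Measure.ae_ne volume 0

lemma ae_isUnit (hS : IsDiffusiveSymbol α c P S) : ∀ᵐ ξ, IsUnit (P ξ) := by
  filter_upwards [hS.orthogonal] with ξ h
  exact ⟨⟨P ξ, star (P ξ), (Matrix.mem_orthogonalGroup_iff _ _).1 h,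
    (Matrix.mem_orthogonalGroup_iff' _ _).1 h⟩, rfl⟩

lemma eqOn_of_ae_eq {f g : Space d → ℝ} (hf : ContinuousOn f {0}ᶜ) (hg : ContinuousOn g {0}ᶜ)
    (h : ∀ᵐ ξ, f ξ = g ξ) {ξ : Space d} (hξ : ξ ≠ 0) : f ξ = g ξ :=
  Measure.eqOn_open_of_ae_eq (ae_restrict_of_ae h) isOpen_compl_singleton hf hg hξ

/-- The symbol is homogeneous of degree `2α`. The identity holds almost everywhere by the
homogeneity of `P`, hence everywhere off the origin by continuity. -/
lemma symbol_smul (hS : IsDiffusiveSymbol α c P S) {a : ℝ} (ha : 0 < a) {ξ : Space d}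
    (hξ : ξ ≠ 0) : S (a • ξ) = a ^ (2 * α) • S ξ := by
  ext i k
  have hmaps : Set.MapsTo (fun ξ : Space d ↦ a • ξ) {0}ᶜ {0}ᶜ := fun x hx ↦ by
    simpa [ha.ne'] using hx
  refine eqOn_of_ae_eq (f := fun ξ ↦ S (a • ξ) i k) (g := fun ξ ↦ (a ^ (2 * α) • S ξ) i k)
    ((hS.smooth i k).continuousOn.comp (by fun_prop) hmaps)
    (continuousOn_const.mul (hS.smooth i k).continuousOn) ?_ hξ
  filter_upwards [hS.symbol_eq,
    (Measure.quasiMeasurePreserving_smul volume ha.ne').ae hS.symbol_eq,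
    hS.ae_diagonalizer_smul ha] with ξ h1 h2 h3
  rw [h2, h1, h3, norm_smul, Real.norm_of_nonneg ha.le, Real.mul_rpow ha.le (norm_nonneg _),
    Matrix.smul_mul_diagonal_mul]
  simp only [mul_left_comm]

/-- The spectral projection of `S(ξ)` (for the eigenvalue `-l|ξ|^{2α}`), as a Lagrange polynomial in
the normalised symbol `-|ξ|^{-2α} S(ξ)`. Contrary to the eigenvectors, that is, the rows of `P`, it
is smooth away from the origin. -/
def spectralProj (α : ℝ) (c : Fin n → ℝ) (S : Space d → Matrix (Fin n) (Fin n) ℝ) (l : ℝ)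
    (ξ : Space d) : Matrix (Fin n) (Fin n) ℝ :=
  Polynomial.aeval (-(‖ξ‖ ^ (2 * α))⁻¹ • S ξ) (Lagrange.basis (Finset.univ.image c) id l)

lemma contDiffOn_norm_rpow (β : ℝ) : ContDiffOn ℝ ∞ (fun ξ : Space d ↦ ‖ξ‖ ^ β) {0}ᶜ :=
  fun _ hξ ↦ ((contDiffAt_id.norm ℝ hξ).rpow_const_of_ne
    (norm_ne_zero_iff.2 hξ)).contDiffWithinAt

lemma contDiffOn_spectralProj (hS : IsDiffusiveSymbol α c P S) (l : ℝ) (i k : Fin n) :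
    ContDiffOn ℝ ∞ (fun ξ ↦ spectralProj α c S l ξ i k) {0}ᶜ := by
  have hB : ∀ i k, ContDiffOn ℝ ∞ (fun ξ ↦ (-(‖ξ‖ ^ (2 * α))⁻¹ • S ξ) i k) {0}ᶜ := fun i k ↦ by
    refine ContDiffOn.mul (ContDiffOn.neg ((contDiffOn_norm_rpow _).inv fun ξ hξ ↦ ?_))
      (hS.smooth i k)
    exact (Real.rpow_pos_of_pos (norm_pos_iff.2 hξ) _).ne'
  have hpow : ∀ (m : ℕ) (i k), ContDiffOn ℝ ∞
      (fun ξ ↦ ((-(‖ξ‖ ^ (2 * α))⁻¹ • S ξ) ^ m) i k) {0}ᶜ := fun m ↦ by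
    induction m with
    | zero => simpa using fun i k ↦ contDiffOn_const
    | succ m ih =>
      intro i k
      simp_rw [pow_succ, Matrix.mul_apply]
      exact ContDiffOn.sum fun j _ ↦ (ih i j).mul (hB j k)
  unfold spectralProj
  simp_rw [Polynomial.aeval_eq_sum_range, Matrix.sum_apply]
  exact ContDiffOn.sum fun m _ ↦ contDiffOn_const.mul (hpow m i k)

lemma continuous_exp_apply (i k : Fin n) :
    Continuous fun A : Matrix (Fin n) (Fin n) ℝ ↦ NormedSpace.exp A i k := by
  let _ : NormedRing (Matrix (Fin n) (Fin n) ℝ) := Matrix.linftyOpNormedRing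
  let _ : NormedAlgebra ℝ (Matrix (Fin n) (Fin n) ℝ) := Matrix.linftyOpNormedAlgebra
  let _ : NormedAlgebra ℚ (Matrix (Fin n) (Fin n) ℝ) := NormedAlgebra.restrictScalars ℚ ℝ _
  exact (NormedSpace.exp_continuous).matrix_elem i k

/-- The spectral decomposition of the semigroup. The eigenvalues have constant multiplicities, so
that the spectral projections are smooth functions of `ξ ≠ 0`. -/
lemma exp_smul_symbol_apply (hd : 1 ≤ d) (hS : IsDiffusiveSymbol α c P S) (t : ℝ) {ξ : Space d}
    (hξ : ξ ≠ 0) (i k : Fin n) :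
    NormedSpace.exp (t • S ξ) i k = ∑ l ∈ Finset.univ.image c,
      Real.exp (-t * (l * ‖ξ‖ ^ (2 * α))) * spectralProj α c S l ξ i k := by
  have hS' : ContinuousOn S {0}ᶜ :=
    continuousOn_pi.2 fun i ↦ continuousOn_pi.2 fun k ↦ (hS.smooth i k).continuousOn
  refine eqOn_of_ae_eq (f := fun ξ ↦ NormedSpace.exp (t • S ξ) i k)
    (g := fun ξ ↦ ∑ l ∈ Finset.univ.image c,
      Real.exp (-t * (l * ‖ξ‖ ^ (2 * α))) * spectralProj α c S l ξ i k)
    ((continuous_exp_apply i k).comp_continuousOn (hS'.const_smul t)) ?_ ?_ hξ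
  · refine continuousOn_finsetSum _ fun l _ ↦ ContinuousOn.mul ?_
      (hS.contDiffOn_spectralProj l i k).continuousOn
    exact Real.continuous_exp.comp_continuousOn
      (continuousOn_const.mul (continuousOn_const.mul (contDiffOn_norm_rpow _).continuousOn))
  filter_upwards [hS.symbol_eq, hS.ae_isUnit, ae_ne_zero hd] with ξ h1 h2 h3
  have hρ : ‖ξ‖ ^ (2 * α) ≠ 0 := (Real.rpow_pos_of_pos (norm_pos_iff.2 h3) _).ne'
  have hB : -(‖ξ‖ ^ (2 * α))⁻¹ • S ξ = (P ξ)⁻¹ * Matrix.diagonal c * P ξ := by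
    rw [h1, Matrix.smul_mul_diagonal_mul]
    congr 3
    ext j
    field_simp
  have htS : t • S ξ = (P ξ)⁻¹ * Matrix.diagonal (fun j ↦ -t * (c j * ‖ξ‖ ^ (2 * α))) * P ξ := by
    rw [h1, Matrix.smul_mul_diagonal_mul]
    congr 3
    ext j
    ring
  have hexp : NormedSpace.exp (t • S ξ) = (P ξ)⁻¹ *
      Matrix.diagonal (fun j ↦ Real.exp (-t * (c j * ‖ξ‖ ^ (2 * α)))) * P ξ := by
    rw [htS, Matrix.exp_conj' _ _ h2, Matrix.exp_diagonal]
    congr 3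
    ext j
    rw [Pi.coe_exp, Real.exp_eq_exp_ℝ]
  have hsum : NormedSpace.exp (t • S ξ) = ∑ l ∈ Finset.univ.image c,
      Real.exp (-t * (l * ‖ξ‖ ^ (2 * α))) • spectralProj α c S l ξ := by
    unfold spectralProj
    simp only [hB, Matrix.aeval_inv_mul_diagonal_mul h2, Matrix.smul_mul_diagonal_mul]
    rw [hexp, ← Finset.sum_mul, ← Finset.mul_sum]
    congr 2
    ext j j'
    rw [Matrix.sum_apply]
    rcases eq_or_ne j j' with rfl | hjj
    · simp only [Matrix.diagonal_apply_eq]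
      have hmem : c j ∈ Finset.univ.image c := Finset.mem_image_of_mem c (Finset.mem_univ j)
      rw [Finset.sum_eq_single_of_mem (c j) hmem]
      · have := Lagrange.eval_basis_self (v := id) (Set.injOn_id _) hmem
        rw [id] at this
        rw [this, mul_one]
      · intro l hl hlc
        have := Lagrange.eval_basis_of_ne (v := id) hlc hmem
        rw [id] at this
        rw [this, mul_zero]
    · simp [Matrix.diagonal_apply_ne _ hjj]
  rw [hsum, Matrix.sum_apply]
  rfl

end IsDiffusiveSymbol

/-! ### Kernels of exponential multipliers localised to an annulus -/

section ExpMultiplier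

lemma ContDiffOn.contDiff_of_tsupport_subset {E F : Type*} [NormedAddCommGroup E] [NormedSpace ℝ E]
    [NormedAddCommGroup F] [NormedSpace ℝ F] {N : WithTop ℕ∞} {f : E → F} {U : Set E}
    (hf : ContDiffOn ℝ N f U) (hU : IsOpen U) (hs : tsupport f ⊆ U) : ContDiff ℝ N f := by
  refine contDiff_iff_contDiffAt.2 fun x ↦ ?_
  by_cases hx : x ∈ tsupport f
  · exact hf.contDiffAt (hU.mem_nhds (hs hx))
  · exact contDiffAt_const.congr_of_eventuallyEq (notMem_tsupport_iff_eventuallyEq.1 hx)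

lemma IsCompact.exists_bound_iteratedFDerivWithin {E F : Type*} [NormedAddCommGroup E]
    [NormedSpace ℝ E] [NormedAddCommGroup F] [NormedSpace ℝ F] {f : E → F} {U K : Set E}
    (hK : IsCompact K) (hU : IsOpen U) (hKU : K ⊆ U) (hf : ContDiffOn ℝ ∞ f U) (n : ℕ) :
    ∃ B : ℝ, 1 ≤ B ∧ ∀ i ≤ n, ∀ x ∈ K, ‖iteratedFDerivWithin ℝ i f U x‖ ≤ B := by
  have h : ∀ i : ℕ, ∃ B : ℝ, ∀ x ∈ K, ‖iteratedFDerivWithin ℝ i f U x‖ ≤ B := fun i ↦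
    hK.exists_bound_of_continuousOn ((hf.continuousOn_iteratedFDerivWithin
      (by exact_mod_cast le_top) hU.uniqueDiffOn).mono hKU)
  choose B hB using h
  obtain ⟨M, hM⟩ := ((Finset.range (n + 1)).image B).exists_le
  refine ⟨max 1 M, le_max_left _ _, fun i hi x hx ↦ (hB i x hx).trans
    ((hM _ (Finset.mem_image_of_mem B (Finset.mem_range.2 (by omega)))).trans (le_max_right _ _))⟩

variable {E : Type*} [NormedAddCommGroup E] [InnerProductSpace ℝ E]

/-- The derivatives of `e^{-τg}` grow polynomially in `τ` relative to `e^{-τg}` itself. -/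
lemma norm_iteratedFDerivWithin_exp_le {g : E → ℝ} {U : Set E} (hU : IsOpen U)
    (hg : ContDiffOn ℝ ∞ g U) {x : E} (hx : x ∈ U) {n : ℕ} {B : ℝ} (hB1 : 1 ≤ B)
    (hB : ∀ i ≤ n, ‖iteratedFDerivWithin ℝ i g U x‖ ≤ B) (τ : ℝ) :
    ‖iteratedFDerivWithin ℝ n (fun y ↦ Real.exp (-τ * g y)) U x‖ ≤
      n.factorial * Real.exp (-τ * g x) * ((1 + |τ|) * B) ^ n := by
  have hτ : 1 ≤ (1 + |τ|) * B := by nlinarith [abs_nonneg τ]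
  refine norm_iteratedFDerivWithin_comp_le (g := Real.exp) (f := fun y ↦ -τ * g y)
    (t := Set.univ) (N := ∞) Real.contDiff_exp.contDiffOn (contDiffOn_const.mul hg)
    (by exact_mod_cast le_top) uniqueDiffOn_univ hU.uniqueDiffOn (Set.mapsTo_univ _ _) hx
    (fun i _ ↦ ?_) fun i hi1 hi ↦ ?_
  · rw [iteratedFDerivWithin_univ, norm_iteratedFDeriv_eq_norm_iteratedDeriv,
      iteratedDeriv_eq_iterate, Real.iter_deriv_exp, Real.norm_of_nonneg (Real.exp_pos _).le]
  · have h1 : iteratedFDerivWithin ℝ i (fun y ↦ -τ * g y) U x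
        = (-τ) • iteratedFDerivWithin ℝ i g U x :=
      iteratedFDerivWithin_const_smul_apply (a := -τ) (f := g)
        ((hg.of_le (by exact_mod_cast le_top)).contDiffWithinAt hx) hU.uniqueDiffOn hx
    rw [h1, norm_smul, norm_neg, Real.norm_eq_abs]
    calc _ ≤ (1 + |τ|) * B := by
          gcongr
          · linarith
          · exact hB i hi
      _ ≤ _ := le_self_pow₀ hτ (by omega)

/-- Half of the exponential decay absorbs the polynomial growth in `τ`. -/
lemma exists_one_add_abs_pow_mul_exp_le {a : ℝ} (ha : 0 < a) (G : ℝ) (n : ℕ) :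
    ∃ A : ℝ, 0 < A ∧ ∀ τ : ℝ, -1 ≤ τ → ∀ y : ℝ, a ≤ y → y ≤ G →
      (1 + |τ|) ^ n * Real.exp (-τ * y) ≤ A * Real.exp (-(a / 2) * τ) := by
  refine ⟨n.factorial * (2 / a) ^ n * Real.exp (a + G), by positivity, fun τ hτ y hay hyG ↦ ?_⟩
  have h1 : 1 + |τ| ≤ 3 + τ := by
    rcases abs_cases τ with h | h <;> linarith
  have h2 : ((3 + τ) * (a / 2)) ^ n ≤ n.factorial * Real.exp ((3 + τ) * (a / 2)) := by
    have := Real.pow_div_factorial_le_exp ((3 + τ) * (a / 2))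
      (mul_nonneg (by linarith) (by linarith)) n
    rwa [div_le_iff₀ (by positivity), mul_comm (Real.exp _)] at this
  have h3 : (3 + τ) ^ n = (2 / a) ^ n * ((3 + τ) * (a / 2)) ^ n := by
    rw [← mul_pow]
    congr 1
    field_simp
  calc (1 + |τ|) ^ n * Real.exp (-τ * y)
      ≤ (3 + τ) ^ n * Real.exp (-(τ + 1) * a + G) := by
        have h4 : (0 : ℝ) ≤ 3 + τ := by linarith
        gcongr
        nlinarith
    _ ≤ ((2 / a) ^ n * (n.factorial * Real.exp ((3 + τ) * (a / 2))))
          * Real.exp (-(τ + 1) * a + G) := by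
        rw [h3]
        gcongr
    _ = n.factorial * (2 / a) ^ n * Real.exp ((3 + τ) * (a / 2) + (-(τ + 1) * a + G)) := by
        rw [Real.exp_add ((3 + τ) * (a / 2))]
        ring
    _ ≤ n.factorial * (2 / a) ^ n * Real.exp ((a + G) + -(a / 2) * τ) := by
        refine mul_le_mul_of_nonneg_left (Real.exp_le_exp.2 ?_) (by positivity)
        nlinarith
    _ = _ := by
        rw [Real.exp_add]
        ring

/-- All Schwartz seminorms of `e^{-τg} h`, for `h` compactly supported where `g` is smooth and
positive, decay exponentially in `τ`. -/
lemma exists_seminorm_exp_le {g : E → ℝ} {h : E → ℂ} {U : Set E} (hU : IsOpen U)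
    (hg : ContDiffOn ℝ ∞ g U) (hh : ContDiff ℝ ∞ h) (hhc : HasCompactSupport h)
    (hhU : tsupport h ⊆ U) {a : ℝ} (ha : 0 < a) (hag : ∀ x ∈ tsupport h, a ≤ g x) (k n : ℕ) :
    ∃ C : ℝ, 0 < C ∧ ∀ τ : ℝ, -1 ≤ τ → ∀ m : 𝓢(E, ℂ),
      (∀ x, m x = Real.exp (-τ * g x) • h x) →
        SchwartzMap.seminorm ℂ k n m ≤ C * Real.exp (-(a / 2) * τ) := by
  have hK : IsCompact (tsupport h) := hhc
  obtain ⟨B, hB1, hB⟩ := hK.exists_bound_iteratedFDerivWithin hU hhU hg n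
  obtain ⟨H, hH1, hH⟩ := hK.exists_bound_iteratedFDerivWithin hU hhU hh.contDiffOn n
  obtain ⟨R, hR⟩ := hK.exists_bound_of_continuousOn (f := fun x : E ↦ x) continuousOn_id
  obtain ⟨G, hG⟩ := hK.exists_bound_of_continuousOn (hg.continuousOn.mono hhU)
  obtain ⟨A, hA0, hA⟩ := exists_one_add_abs_pow_mul_exp_le ha G n
  refine ⟨|R| ^ k * ∑ i ∈ Finset.range (n + 1), (n.choose i) * (i.factorial * B ^ n * H) * A + 1,
    by positivity, fun τ hτ m hm ↦ SchwartzMap.seminorm_le_bound ℂ k n m (by positivity) fun x ↦ ?_⟩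
  by_cases hx : x ∈ tsupport h
  · have hxU := hhU hx
    have hm' : (m : E → ℂ) = fun x ↦ Real.exp (-τ * g x) • h x := funext hm
    have hτ1 : 1 ≤ 1 + |τ| := by linarith [abs_nonneg τ]
    rw [← iteratedFDerivWithin_of_isOpen n hU hxU, hm']
    have h1 := norm_iteratedFDerivWithin_smul_le (N := ∞)
      (Real.contDiff_exp.comp_contDiffOn
        (contDiffOn_const.mul hg : ContDiffOn ℝ ∞ (fun x ↦ -τ * g x) U))
      (hh.contDiffOn (s := U)) hU.uniqueDiffOn hxU (n := n) (by exact_mod_cast le_top)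
    have hxR : ‖x‖ ≤ |R| := (hR x hx).trans (le_abs_self R)
    have hGx : g x ≤ G := (le_abs_self _).trans (hG x hx)
    calc _ ≤ |R| ^ k * ∑ i ∈ Finset.range (n + 1), (n.choose i) * (i.factorial * B ^ n * H) *
          (A * Real.exp (-(a / 2) * τ)) := by
          gcongr
          refine h1.trans (Finset.sum_le_sum fun i hi ↦ ?_)
          have hin : i ≤ n := by simpa [Nat.lt_succ_iff] using hi
          have h2 := norm_iteratedFDerivWithin_exp_le hU hg hxU hB1
            (fun j hj ↦ hB j (hj.trans hin) x hx) τ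
          rw [mul_assoc, mul_assoc (n.choose i : ℝ)]
          refine mul_le_mul_of_nonneg_left ?_ (by positivity)
          calc _ ≤ (i.factorial * Real.exp (-τ * g x) * ((1 + |τ|) * B) ^ i) * H := by
                gcongr
                · exact h2
                · exact hH _ (Nat.sub_le n i) x hx
            _ ≤ (i.factorial * Real.exp (-τ * g x) * ((1 + |τ|) * B) ^ n) * H := by
                gcongr
                exact one_le_mul_of_one_le_of_one_le hτ1 hB1
            _ = i.factorial * B ^ n * H * ((1 + |τ|) ^ n * Real.exp (-τ * g x)) := by
                rw [mul_pow]
                ring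
            _ ≤ _ := by
                refine mul_le_mul_of_nonneg_left ?_ (by positivity)
                exact hA τ hτ _ (hag x hx) hGx
      _ = (|R| ^ k * ∑ i ∈ Finset.range (n + 1), (n.choose i) * (i.factorial * B ^ n * H) * A)
          * Real.exp (-(a / 2) * τ) := by
          simp only [← mul_assoc, Finset.sum_mul, Finset.mul_sum]
      _ ≤ _ := by
          gcongr
          linarith
  · have h0 : iteratedFDeriv ℝ n m x = 0 := by
      have h2 : (m : E → ℂ) =ᶠ[nhds x] fun _ ↦ 0 := by
        filter_upwards [notMem_tsupport_iff_eventuallyEq.1 hx] with y hy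
        rw [hm, hy]
        simp
      have h3 := (h2.iteratedFDeriv ℝ n).eq_of_nhds
      rw [h3, iteratedFDeriv_fun_zero]
      rfl
    rw [h0, norm_zero, mul_zero]
    positivity

variable [FiniteDimensional ℝ E] [MeasurableSpace E] [BorelSpace E]

/-- The kernels of `e^{-τg} h` decay exponentially in `L¹`. -/
lemma exists_kernelNorm_exp_le {g : E → ℝ} {h : E → ℂ} {U : Set E} (hU : IsOpen U)
    (hg : ContDiffOn ℝ ∞ g U) (hh : ContDiff ℝ ∞ h) (hhc : HasCompactSupport h)
    (hhU : tsupport h ⊆ U) {a : ℝ} (ha : 0 < a) (hag : ∀ x ∈ tsupport h, a ≤ g x) :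
    ∃ C : ℝ, 0 < C ∧ ∀ τ : ℝ, -1 ≤ τ → kernelNorm (fun x ↦ Real.exp (-τ * g x) • h x) ≤
      ENNReal.ofReal (C * Real.exp (-(a / 2) * τ)) := by
  obtain ⟨s, C₀, hC₀⟩ := exists_kernelNorm_le_seminorm E
  choose C hC0 hC using exists_seminorm_exp_le hU hg hh hhc hhU ha hag
  refine ⟨C₀ * (∑ j ∈ s, C j.1 j.2) + 1, by
    have := Finset.sum_nonneg fun (j : ℕ × ℕ) (_ : j ∈ s) ↦ (hC0 j.1 j.2).le
    positivity, fun τ hτ ↦ ?_⟩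
  have hts : tsupport (fun x ↦ Real.exp (-τ * g x) • h x) ⊆ tsupport h :=
    tsupport_smul_subset_right _ _
  have hsm : ContDiff ℝ ∞ (fun x ↦ Real.exp (-τ * g x) • h x) :=
    ContDiffOn.contDiff_of_tsupport_subset ((Real.contDiff_exp.comp_contDiffOn
      (contDiffOn_const.mul hg)).smul hh.contDiffOn) hU (hts.trans hhU)
  have hcs : HasCompactSupport (fun x ↦ Real.exp (-τ * g x) • h x) :=
    hhc.of_isClosed_subset (isClosed_tsupport _) hts
  set m : 𝓢(E, ℂ) := hcs.toSchwartzMap hsm with hm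
  have hmx : ∀ x, m x = Real.exp (-τ * g x) • h x := fun x ↦ rfl
  refine (hC₀ m).trans (ENNReal.ofReal_le_ofReal ?_)
  have h1 : (s.sup (schwartzSeminormFamily ℂ E ℂ)) m
      ≤ (∑ j ∈ s, C j.1 j.2) * Real.exp (-(a / 2) * τ) := by
    rw [Finset.sum_mul]
    have hnn : ∀ j ∈ s, 0 ≤ C j.1 j.2 * Real.exp (-(a / 2) * τ) := fun j _ ↦
      mul_nonneg (hC0 _ _).le (Real.exp_pos _).le
    refine Seminorm.finset_sup_apply_le (Finset.sum_nonneg hnn) fun j hj ↦ ?_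
    exact (hC j.1 j.2 τ hτ m hmx).trans (Finset.single_le_sum hnn hj)
  calc _ ≤ C₀ * ((∑ j ∈ s, C j.1 j.2) * Real.exp (-(a / 2) * τ)) := by gcongr
    _ = (C₀ * (∑ j ∈ s, C j.1 j.2)) * Real.exp (-(a / 2) * τ) := by ring
    _ ≤ _ := by
      gcongr
      linarith

end ExpMultiplier

/-! ### Symbols localised to dyadic annuli -/

section Cutoff

variable {d : ℕ} {χ : Space d → ℝ}

/-- The cutoff `χ(aξ) - χ(bξ)` to the annulus `3/(4b) ≤ |ξ| ≤ 4/(3a)`. -/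
def bandCutoff (χ : Space d → ℝ) (a b : ℝ) (ξ : Space d) : ℝ := χ (a • ξ) - χ (b • ξ)

lemma annulusCutoff_eq_bandCutoff (χ : Space d → ℝ) : annulusCutoff χ = bandCutoff χ (1 / 2) 1 := by
  ext ξ
  simp [annulusCutoff, bandCutoff]

namespace IsLPCutoff

lemma apply_eq_one (hχ : IsLPCutoff χ) {ξ : Space d} (h : ‖ξ‖ < 3 / 4) : χ ξ = 1 :=
  hχ.eq_one ξ (by simpa using h)

lemma apply_eq_zero (hχ : IsLPCutoff χ) {ξ : Space d} (h : 4 / 3 ≤ ‖ξ‖) : χ ξ = 0 := by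
  refine image_eq_zero_of_notMem_tsupport fun hmem ↦ ?_
  have := hχ.support hmem
  rw [mem_ball_zero_iff] at this
  linarith

lemma contDiff_bandCutoff (hχ : IsLPCutoff χ) (a b : ℝ) : ContDiff ℝ ∞ (bandCutoff χ a b) :=
  (hχ.smooth.comp (contDiff_const_smul a)).sub (hχ.smooth.comp (contDiff_const_smul b))

lemma bandCutoff_eq_zero_of_le (hχ : IsLPCutoff χ) {a b : ℝ} (ha : 0 < a) (hab : a ≤ b)
    {ξ : Space d} (h : 4 / (3 * a) ≤ ‖ξ‖) : bandCutoff χ a b ξ = 0 := by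
  rw [div_le_iff₀ (by positivity)] at h
  have h1 : 4 / 3 ≤ a * ‖ξ‖ := by linarith
  have h2 : 4 / 3 ≤ b * ‖ξ‖ := h1.trans (by gcongr)
  rw [bandCutoff, hχ.apply_eq_zero, hχ.apply_eq_zero, sub_zero]
  · rwa [norm_smul, Real.norm_of_nonneg (ha.le.trans hab)]
  · rwa [norm_smul, Real.norm_of_nonneg ha.le]

lemma bandCutoff_eq_zero_of_lt (hχ : IsLPCutoff χ) {a b : ℝ} (ha : 0 < a) (hab : a ≤ b)
    {ξ : Space d} (h : ‖ξ‖ < 3 / (4 * b)) : bandCutoff χ a b ξ = 0 := by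
  rw [lt_div_iff₀ (by linarith)] at h
  have h1 : b * ‖ξ‖ < 3 / 4 := by linarith
  have h2 : a * ‖ξ‖ < 3 / 4 := h1.trans_le' (by gcongr)
  rw [bandCutoff, hχ.apply_eq_one, hχ.apply_eq_one, sub_self]
  · rwa [norm_smul, Real.norm_of_nonneg (ha.le.trans hab)]
  · rwa [norm_smul, Real.norm_of_nonneg ha.le]

lemma hasCompactSupport_bandCutoff (hχ : IsLPCutoff χ) {a b : ℝ} (ha : 0 < a) (hab : a ≤ b) :
    HasCompactSupport (bandCutoff χ a b) := by
  refine HasCompactSupport.of_support_subset_isCompact (isCompact_closedBall 0 (4 / (3 * a)))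
    fun ξ hξ ↦ ?_
  rw [mem_closedBall_zero_iff]
  by_contra! h
  exact hξ (hχ.bandCutoff_eq_zero_of_le ha hab h.le)

lemma tsupport_bandCutoff_subset (hχ : IsLPCutoff χ) {a b : ℝ} (ha : 0 < a) (hab : a ≤ b) :
    tsupport (bandCutoff χ a b) ⊆ {ξ | 3 / (4 * b) ≤ ‖ξ‖} := by
  refine closure_minimal (fun ξ hξ ↦ ?_) (isClosed_le continuous_const continuous_norm)
  by_contra! h
  exact hξ (hχ.bandCutoff_eq_zero_of_lt ha hab (by simpa using h))

/-- The wider cutoff `χ(ξ/4) - χ(2ξ)` equals `1` on the support of the Littlewood–Paley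
function. -/
lemma bandCutoff_eq_one (hχ : IsLPCutoff χ) {ξ : Space d} (h : annulusCutoff χ ξ ≠ 0) :
    bandCutoff χ (1 / 4) 2 ξ = 1 := by
  rw [annulusCutoff_eq_bandCutoff] at h
  have h1 : ‖ξ‖ < 4 / (3 * (1 / 2)) := by
    by_contra! h'
    exact h (hχ.bandCutoff_eq_zero_of_le (by norm_num) (by norm_num) h')
  have h2 : 3 / (4 * 1) ≤ ‖ξ‖ := by
    by_contra! h'
    exact h (hχ.bandCutoff_eq_zero_of_lt (by norm_num) (by norm_num) h')
  rw [bandCutoff, hχ.apply_eq_one, hχ.apply_eq_zero, sub_zero]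
  · rw [norm_smul, Real.norm_of_nonneg (by norm_num)]
    linarith
  · rw [norm_smul, Real.norm_of_nonneg (by norm_num)]
    linarith

end IsLPCutoff

end Cutoff

section KernelNormSum

variable {E : Type*} [NormedAddCommGroup E] [InnerProductSpace ℝ E] [FiniteDimensional ℝ E]
  [MeasurableSpace E] [BorelSpace E]

lemma kernelNorm_sum_le {ι : Type*} (s : Finset ι) (m : ι → 𝓢(E, ℂ)) :
    kernelNorm (∑ l ∈ s, m l : 𝓢(E, ℂ)) ≤ ∑ l ∈ s, kernelNorm (m l) := by
  refine Finset.le_sum_of_subadditive (fun m : 𝓢(E, ℂ) ↦ kernelNorm m) ?_ (fun m₁ m₂ ↦ ?_) s m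
  · have h : 𝓕 (0 : 𝓢(E, ℂ)) = 0 := map_zero (FourierTransform.fourierCLM ℂ 𝓢(E, ℂ))
    simp only [kernelNorm, ← SchwartzMap.fourier_coe, h]
    simp
  · simp only [kernelNorm, ← SchwartzMap.fourier_coe, FourierTransform.fourier_add]
    rw [← lintegral_add_left (𝓕 m₁).continuous.enorm.measurable]
    exact lintegral_mono fun x ↦ enorm_add_le _ _

end KernelNormSum

namespace IsDiffusiveSymbol

variable {d n : ℕ} {χ : Space d → ℝ} {α : ℝ} {c : Fin n → ℝ}
  {P S : Space d → Matrix (Fin n) (Fin n) ℝ}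

/-- On a fixed annulus the semigroup has kernels decaying exponentially in time. Times down to `-1`
are included in order to invert the semigroup for short times. -/
lemma exists_kernelNorm_annulus_le (hd : 1 ≤ d) (hχ : IsLPCutoff χ)
    (hS : IsDiffusiveSymbol α c P S) :
    ∃ C κ : ℝ, 0 < C ∧ 0 < κ ∧ ∀ τ : ℝ, -1 ≤ τ → ∀ i k, ∃ m : 𝓢(Space d, ℂ),
      (∀ η, m η = ((NormedSpace.exp (τ • S η) i k * bandCutoff χ (1 / 4) 2 η : ℝ) : ℂ)) ∧
      kernelNorm m ≤ ENNReal.ofReal (C * Real.exp (-κ * τ)) := by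
  set s : Finset ℝ := Finset.univ.image c with hs
  have hpos : ∀ l ∈ s, 0 < l := fun l hl ↦ by
    obtain ⟨i, -, rfl⟩ := Finset.mem_image.1 hl
    exact hS.coeff_pos i
  -- A common lower bound for the eigenvalues.
  obtain ⟨a, ha, hal⟩ : ∃ a : ℝ, 0 < a ∧ ∀ l ∈ s, a ≤ l := by
    rcases s.eq_empty_or_nonempty with h | h
    · exact ⟨1, one_pos, by simp [h]⟩
    · exact ⟨s.min' h, hpos _ (s.min'_mem h), fun l hl ↦ s.min'_le l hl⟩
  set φ : Space d → ℝ := bandCutoff χ (1 / 4) 2 with hφ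
  have hφs : tsupport φ ⊆ {ξ | 3 / (4 * 2) ≤ ‖ξ‖} :=
    hχ.tsupport_bandCutoff_subset (by norm_num) (by norm_num)
  have hφc : HasCompactSupport φ := hχ.hasCompactSupport_bandCutoff (by norm_num) (by norm_num)
  have hne : ∀ ξ : Space d, 3 / (4 * 2) ≤ ‖ξ‖ → ξ ∈ ({0}ᶜ : Set (Space d)) := fun ξ h h0 ↦ by
    rw [Set.mem_singleton_iff.1 h0, norm_zero] at h
    norm_num at h
  have hopen : IsOpen ({0}ᶜ : Set (Space d)) := isOpen_compl_singleton
  let h : ℝ → Fin n → Fin n → Space d → ℂ := fun l i k η ↦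
    ((spectralProj α c S l η i k * φ η : ℝ) : ℂ)
  have hts : ∀ l i k, tsupport (h l i k) ⊆ tsupport φ := fun l i k ↦ by
    refine closure_mono fun x hx hx0 ↦ hx ?_
    simp [h, hx0]
  have hhU : ∀ l i k, tsupport (h l i k) ⊆ {0}ᶜ := fun l i k x hx ↦ hne x (hφs (hts l i k hx))
  have hhs : ∀ l i k, ContDiff ℝ ∞ (h l i k) := fun l i k ↦
    (Complex.ofRealCLM.contDiff.comp_contDiffOn ((hS.contDiffOn_spectralProj l i k).mul
      (hχ.contDiff_bandCutoff _ _).contDiffOn)).contDiff_of_tsupport_subset hopen (hhU l i k)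
  have hhc : ∀ l i k, HasCompactSupport (h l i k) := fun l i k ↦
    hφc.of_isClosed_subset (isClosed_tsupport _) (hts l i k)
  have hg : ∀ l : ℝ, ContDiffOn ℝ ∞ (fun ξ : Space d ↦ l * ‖ξ‖ ^ (2 * α)) {0}ᶜ := fun l ↦
    contDiffOn_const.mul (contDiffOn_norm_rpow _)
  set b : ℝ := a * (3 / (4 * 2)) ^ (2 * α) with hb
  have hb0 : 0 < b := by positivity
  have hkey : ∀ l i k, ∃ C : ℝ, 0 < C ∧ (l ∈ s → ∀ τ : ℝ, -1 ≤ τ →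
      kernelNorm (fun x ↦ Real.exp (-τ * (l * ‖x‖ ^ (2 * α))) • h l i k x) ≤
        ENNReal.ofReal (C * Real.exp (-(b / 2) * τ))) := fun l i k ↦ by
    by_cases hl : l ∈ s
    · obtain ⟨C, hC, hC'⟩ := exists_kernelNorm_exp_le hopen (hg l) (hhs l i k) (hhc l i k)
        (hhU l i k) hb0 fun x hx ↦ by
          have h1 : 3 / (4 * 2) ≤ ‖x‖ := hφs (hts l i k hx)
          have h2 := hS.order_pos
          have h3 := hal l hl
          change a * (3 / (4 * 2)) ^ (2 * α) ≤ l * ‖x‖ ^ (2 * α)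
          have h4 := ha.le.trans h3
          gcongr
      exact ⟨C, hC, fun _ ↦ hC'⟩
    · exact ⟨1, one_pos, fun h ↦ absurd h hl⟩
  choose C hC0 hC using hkey
  refine ⟨(∑ l ∈ s, ∑ i, ∑ k, C l i k) + 1, b / 2, ?_, by positivity, fun τ hτ i k ↦ ?_⟩
  · have := Finset.sum_nonneg fun l (_ : l ∈ s) ↦ Finset.sum_nonneg fun i (_ : i ∈ Finset.univ) ↦
      Finset.sum_nonneg fun k (_ : k ∈ Finset.univ) ↦ (hC0 l i k).le
    positivity
  have hexp : ∀ l, ContDiffOn ℝ ∞ (fun η : Space d ↦ Real.exp (-τ * (l * ‖η‖ ^ (2 * α)))) {0}ᶜ :=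
    fun l ↦ Real.contDiff_exp.comp_contDiffOn (contDiffOn_const.mul (hg l))
  have hts' : ∀ l, tsupport (fun η ↦ Real.exp (-τ * (l * ‖η‖ ^ (2 * α))) • h l i k η) ⊆
      tsupport (h l i k) := fun l ↦ tsupport_smul_subset_right _ _
  let m : ℝ → 𝓢(Space d, ℂ) := fun l ↦ HasCompactSupport.toSchwartzMap
    (f := fun η ↦ Real.exp (-τ * (l * ‖η‖ ^ (2 * α))) • h l i k η)
    ((hhc l i k).of_isClosed_subset (isClosed_tsupport _) (hts' l))
    (((hexp l).smul (hhs l i k).contDiffOn).contDiff_of_tsupport_subset hopen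
      ((hts' l).trans (hhU l i k)))
  have hm : ∀ l η, m l η = Real.exp (-τ * (l * ‖η‖ ^ (2 * α))) • h l i k η := fun l η ↦ rfl
  refine ⟨∑ l ∈ s, m l, fun η ↦ ?_, (kernelNorm_sum_le s m).trans ?_⟩
  · rw [sum_apply]
    simp_rw [hm]
    by_cases hη : η = 0
    · have h0 : φ η = 0 :=
        hχ.bandCutoff_eq_zero_of_lt (by norm_num) (by norm_num) (by simp [hη])
      simp [h, h0]
    · rw [hS.exp_smul_symbol_apply hd τ hη, Finset.sum_mul, Complex.ofReal_sum]
      refine Finset.sum_congr rfl fun l _ ↦ ?_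
      simp [h, mul_assoc]
  · calc ∑ l ∈ s, kernelNorm (m l)
        ≤ ∑ l ∈ s, ENNReal.ofReal (C l i k * Real.exp (-(b / 2) * τ)) :=
          Finset.sum_le_sum fun l hl ↦ hC l i k hl τ hτ
      _ = ENNReal.ofReal ((∑ l ∈ s, C l i k) * Real.exp (-(b / 2) * τ)) := by
          rw [Finset.sum_mul, ENNReal.ofReal_sum_of_nonneg]
          exact fun l _ ↦ mul_nonneg (hC0 l i k).le (Real.exp_pos _).le
      _ ≤ _ := by
          gcongr
          refine (Finset.sum_le_sum fun l _ ↦ ?_).trans (le_add_of_nonneg_right zero_le_one)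
          refine (Finset.single_le_sum (f := fun k ↦ C l i k) (fun k _ ↦ (hC0 l i k).le)
            (Finset.mem_univ k)).trans ?_
          exact Finset.single_le_sum (f := fun i ↦ ∑ k, C l i k)
            (fun i _ ↦ Finset.sum_nonneg fun k _ ↦ (hC0 l i k).le) (Finset.mem_univ i)

/-- By homogeneity, the bound on a fixed annulus holds on the annulus of size `2^j` with the time
rescaled by `2^{2αj}`. -/
lemma exists_kernelNorm_dyadic_le (hd : 1 ≤ d) (hχ : IsLPCutoff χ)
    (hS : IsDiffusiveSymbol α c P S) :
    ∃ C κ : ℝ, 0 < C ∧ 0 < κ ∧ ∀ (t : ℝ) (j : ℤ), -1 ≤ t * (2 : ℝ) ^ (2 * α * j) →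
      ∀ i k, ∃ m : 𝓢(Space d, ℂ),
      (∀ ξ, m ξ = ((NormedSpace.exp (t • S ((2 * Real.pi) • ξ)) i k *
        bandCutoff χ (1 / 4) 2 ((2 : ℝ) ^ (-j) • ((2 * Real.pi) • ξ)) : ℝ) : ℂ)) ∧
      kernelNorm m ≤ ENNReal.ofReal (C * Real.exp (-κ * (t * (2 : ℝ) ^ (2 * α * j)))) := by
  obtain ⟨C, κ, hC, hκ, h⟩ := hS.exists_kernelNorm_annulus_le hd hχ
  refine ⟨C, κ, hC, hκ, fun t j htj i k ↦ ?_⟩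
  obtain ⟨m, hm, hmk⟩ := h _ htj i k
  have ha : 0 < (2 : ℝ) ^ (-j) * (2 * Real.pi) := by positivity
  have hcoe : ∀ ξ, SchwartzMap.compCLMOfContinuousLinearEquiv ℂ (ContinuousLinearEquiv.smulLeft
      (M₁ := Space d) (R₁ := ℝ) (Units.mk0 _ ha.ne')) m ξ
        = m (((2 : ℝ) ^ (-j) * (2 * Real.pi)) • ξ) := fun ξ ↦ rfl
  refine ⟨SchwartzMap.compCLMOfContinuousLinearEquiv ℂ (ContinuousLinearEquiv.smulLeft
      (M₁ := Space d) (R₁ := ℝ) (Units.mk0 _ ha.ne')) m, fun ξ ↦ ?_, ?_⟩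
  · rw [hcoe, hm, smul_smul ((2 : ℝ) ^ (-j))]
    by_cases hξ : ξ = 0
    · have h0 : bandCutoff χ (1 / 4) 2 (0 : Space d) = 0 :=
        hχ.bandCutoff_eq_zero_of_lt (by norm_num) (by norm_num) (by simp)
      rw [hξ, smul_zero, smul_zero, h0, mul_zero, mul_zero]
    · have h1 : (2 * Real.pi) • ξ = (2 : ℝ) ^ j • (((2 : ℝ) ^ (-j) * (2 * Real.pi)) • ξ) := by
        rw [smul_smul, ← mul_assoc, ← zpow_add₀ two_ne_zero, add_neg_cancel, zpow_zero, one_mul]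
      have h2 : ((2 : ℝ) ^ j) ^ (2 * α) = (2 : ℝ) ^ (2 * α * j) := by
        rw [← Real.rpow_intCast, ← Real.rpow_mul two_pos.le, mul_comm (j : ℝ)]
      rw [h1, hS.symbol_smul (by positivity) (smul_ne_zero ha.ne' hξ), smul_smul, h2]
  · have h2 := kernelNorm_comp_smul (E := Space d) m ha
    rwa [funext hcoe, h2]

end IsDiffusiveSymbol

/-! ### Dyadic blocks of multiplier relations -/

section Blocks

variable {d n : ℕ} {χ : Space d → ℝ}

/-- The symbol of the dyadic block `Δ_j`, in the frequency variable of Mathlib's Fourier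
transform. -/
def blockSymbol (χ : Space d → ℝ) (j : ℤ) (ξ : Space d) : ℂ :=
  (annulusCutoff χ ((2 : ℝ) ^ (-j) • ((2 * Real.pi) • ξ)) : ℂ)

lemma IsLPCutoff.contDiff_blockSymbol (hχ : IsLPCutoff χ) (j : ℤ) :
    ContDiff ℝ ∞ (blockSymbol χ j) := by
  unfold blockSymbol
  rw [annulusCutoff_eq_bandCutoff]
  exact Complex.ofRealCLM.contDiff.comp ((hχ.contDiff_bandCutoff _ _).comp
    ((contDiff_const_smul _).comp (contDiff_const_smul _)))

lemma IsLPCutoff.tsupport_blockSymbol (hχ : IsLPCutoff χ) (j : ℤ) :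
    HasCompactSupport (blockSymbol χ j) ∧ (0 : Space d) ∉ tsupport (blockSymbol χ j) := by
  have ha : (2 : ℝ) ^ (-j) * (2 * Real.pi) ≠ 0 := by positivity
  have h : blockSymbol χ j = (fun ξ ↦ ((bandCutoff χ (1 / 2) 1 ξ : ℝ) : ℂ)) ∘
      (Homeomorph.smulOfNeZero (α := Space d) _ ha) := by
    ext ξ
    simp [blockSymbol, annulusCutoff_eq_bandCutoff, smul_smul]
  have h1 : tsupport (fun ξ : Space d ↦ ((bandCutoff χ (1 / 2) 1 ξ : ℝ) : ℂ))
      ⊆ tsupport (bandCutoff χ (1 / 2) 1) := by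
    refine closure_mono fun x hx hx0 ↦ hx ?_
    simp only [hx0, Complex.ofReal_zero]
  have h2 : HasCompactSupport (fun ξ : Space d ↦ ((bandCutoff χ (1 / 2) 1 ξ : ℝ) : ℂ)) :=
    (hχ.hasCompactSupport_bandCutoff (by norm_num) (by norm_num)).of_isClosed_subset
      (isClosed_tsupport _) h1
  refine ⟨h ▸ h2.comp_homeomorph _, fun h0 ↦ ?_⟩
  rw [h, tsupport_comp_eq_preimage] at h0
  have h3 := hχ.tsupport_bandCutoff_subset (by norm_num) (by norm_num) (h1 h0)
  norm_num at h3

lemma IsLPCutoff.hasTemperateGrowth_blockSymbol (hχ : IsLPCutoff χ) (j : ℤ) :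
    (blockSymbol χ j).HasTemperateGrowth :=
  ((hχ.tsupport_blockSymbol j).1.toSchwartzMap (hχ.contDiff_blockSymbol j)).hasTemperateGrowth

lemma dyadicBlock_apply (χ : Space d → ℝ) (j : ℤ) (u : TDist d) (g : 𝓢(Space d, ℂ)) :
    dyadicBlock χ j u g = 𝓕 u (SchwartzMap.smulLeftCLM ℂ (blockSymbol χ j) (𝓕⁻ g)) := rfl

/-- The dyadic blocks of `v = M(D) u` are obtained from those of `u` by the symbol `M` cut off to a
slightly larger annulus. -/
lemma IsFourierMultiplier.dyadicBlock_eq (hχ : IsLPCutoff χ)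
    {M : Space d → Matrix (Fin n) (Fin n) ℝ} {u v : Fin n → TDist d}
    (huv : IsFourierMultiplier M u v) (i : Fin n) (j : ℤ) (m : Fin n → 𝓢(Space d, ℂ))
    (hm : ∀ k ξ, m k ξ = ((M ((2 * Real.pi) • ξ) i k *
        bandCutoff χ (1 / 4) 2 ((2 : ℝ) ^ (-j) • ((2 * Real.pi) • ξ)) : ℝ) : ℂ)) :
    dyadicBlock χ j (v i) =
      ∑ k, TemperedDistribution.fourierMultiplierCLM ℂ (m k) (dyadicBlock χ j (u k)) := by
  ext g
  have hb := hχ.hasTemperateGrowth_blockSymbol j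
  obtain ⟨hc, h0⟩ := hχ.tsupport_blockSymbol j
  set θ : 𝓢(Space d, ℂ) := SchwartzMap.smulLeftCLM ℂ (blockSymbol χ j) (𝓕⁻ g) with hθ
  have hsub : tsupport θ ⊆ tsupport (blockSymbol χ j) :=
    (SchwartzMap.tsupport_smulLeftCLM_subset _ _).trans Set.inter_subset_right
  rw [dyadicBlock_apply, ← hθ, huv i θ (fun k ↦ SchwartzMap.smulLeftCLM ℂ (m k) θ)
    (hc.of_isClosed_subset (isClosed_tsupport _) hsub) (fun h ↦ h0 (hsub h)) fun k ξ ↦ ?_,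
    sum_apply]
  · refine Finset.sum_congr rfl fun k _ ↦ ?_
    rw [TemperedDistribution.fourierMultiplierCLM_apply_apply, dyadicBlock_apply,
      FourierTransform.fourierInv_fourier_eq, hθ,
      SchwartzMap.smulLeftCLM_smulLeftCLM_apply (m k).hasTemperateGrowth hb,
      SchwartzMap.smulLeftCLM_smulLeftCLM_apply hb (m k).hasTemperateGrowth, mul_comm]
  · rw [SchwartzMap.smulLeftCLM_apply_apply (m k).hasTemperateGrowth, hm, smul_eq_mul]
    by_cases hz : annulusCutoff χ ((2 : ℝ) ^ (-j) • ((2 * Real.pi) • ξ)) = 0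
    · have : θ ξ = 0 := by
        rw [hθ, SchwartzMap.smulLeftCLM_apply_apply hb]
        simp only [blockSymbol, hz, Complex.ofReal_zero, zero_smul]
      rw [this, mul_zero, mul_zero]
    · rw [hχ.bandCutoff_eq_one hz, mul_one]

/-- Bounds for the kernels of the localised symbol are bounds for the dyadic blocks. -/
lemma IsFourierMultiplier.blockNorm_le (hχ : IsLPCutoff χ)
    {M : Space d → Matrix (Fin n) (Fin n) ℝ} {u v : Fin n → TDist d}
    (huv : IsFourierMultiplier M u v) (j : ℤ) {p : ℝ≥0∞} [Fact (1 ≤ p)] {K : ℝ} (hK : 0 < K)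
    (h : ∀ i k, ∃ m : 𝓢(Space d, ℂ), (∀ ξ, m ξ = ((M ((2 * Real.pi) • ξ) i k *
        bandCutoff χ (1 / 4) 2 ((2 : ℝ) ^ (-j) • ((2 * Real.pi) • ξ)) : ℝ) : ℂ)) ∧
      kernelNorm m ≤ ENNReal.ofReal K) :
    blockNorm χ p v j ≤ ENNReal.ofReal (n * K) * blockNorm χ p u j := by
  choose m hm hmK using h
  have hK0 : ENNReal.ofReal K ≠ 0 := by simpa using hK
  calc blockNorm χ p v j
      ≤ ∑ _i : Fin n, ∑ k, ENNReal.ofReal K * distLpNorm p (dyadicBlock χ j (u k)) := by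
        refine Finset.sum_le_sum fun i _ ↦ ?_
        rw [huv.dyadicBlock_eq hχ i j (m i) (hm i)]
        refine (distLpNorm_sum_le _ _).trans (Finset.sum_le_sum fun k _ ↦ ?_)
        exact distLpNorm_fourierMultiplierCLM_le _ (m i k) hK0 ENNReal.ofReal_ne_top (hmK i k)
    _ = _ := by
        rw [← Finset.mul_sum, Finset.sum_const, Finset.card_univ, Fintype.card_fin, nsmul_eq_mul,
          ENNReal.ofReal_mul (by positivity), ENNReal.ofReal_natCast, mul_assoc]
        rfl

/-- Inversion of a multiplier relation away from the origin. -/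
lemma IsFourierMultiplier.symm {M N : Space d → Matrix (Fin n) (Fin n) ℝ} {u v : Fin n → TDist d}
    (huv : IsFourierMultiplier M u v) (hM : ∀ i k, ContDiffOn ℝ ∞ (fun ξ ↦ M ξ i k) {0}ᶜ)
    (hNM : ∀ ξ, N ξ * M ξ = 1) : IsFourierMultiplier N v u := by
  intro i θ ψ hθc hθ0 hψ
  have hmaps : Set.MapsTo (fun ξ : Space d ↦ (2 * Real.pi) • ξ) {0}ᶜ {0}ᶜ := fun x hx ↦ by
    simpa [Real.pi_ne_zero] using hx
  have hU : tsupport θ ⊆ {0}ᶜ := fun x hx h0 ↦ hθ0 (Set.mem_singleton_iff.1 h0 ▸ hx)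
  have hψs : ∀ k, tsupport (ψ k) ⊆ tsupport θ := fun k ↦ by
    refine closure_mono fun x hx hx0 ↦ hx ?_
    simp [hψ, hx0]
  let f : Fin n → Fin n → Space d → ℂ := fun k l ξ ↦
    ((M ((2 * Real.pi) • ξ) k l : ℝ) : ℂ) * ψ k ξ
  have hfs : ∀ k l, tsupport (f k l) ⊆ tsupport θ := fun k l ↦
    (tsupport_mul_subset_right (f := fun ξ ↦ ((M ((2 * Real.pi) • ξ) k l : ℝ) : ℂ))).trans (hψs k)
  have hfd : ∀ k l, ContDiff ℝ ∞ (f k l) := fun k l ↦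
    ContDiffOn.contDiff_of_tsupport_subset
      ((Complex.ofRealCLM.contDiff.comp_contDiffOn
        ((hM k l).comp (contDiff_const_smul _).contDiffOn hmaps)).mul ((ψ k).smooth ⊤).contDiffOn)
      isOpen_compl_singleton ((hfs k l).trans hU)
  have hfc : ∀ k l, HasCompactSupport (f k l) := fun k l ↦
    hθc.of_isClosed_subset (isClosed_tsupport _) (hfs k l)
  let F : Fin n → Fin n → 𝓢(Space d, ℂ) := fun k l ↦ (hfc k l).toSchwartzMap (hfd k l)
  have hF : ∀ k l ξ, F k l ξ = ((M ((2 * Real.pi) • ξ) k l : ℝ) : ℂ) * ψ k ξ := fun _ _ _ ↦ rfl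
  have h1 : ∀ k, 𝓕 (v k) (ψ k) = ∑ l, 𝓕 (u l) (F k l) := fun k ↦
    huv k (ψ k) (F k) (hθc.of_isClosed_subset (isClosed_tsupport _) (hψs k))
      (fun h ↦ hθ0 (hψs k h)) (hF k)
  have h2 : ∀ l, ∑ k, F k l = if l = i then θ else 0 := fun l ↦ by
    ext ξ
    rw [sum_apply]
    simp_rw [hF, hψ]
    have h3 : ∑ k, ((M ((2 * Real.pi) • ξ) k l : ℝ) : ℂ)
        * (((N ((2 * Real.pi) • ξ) i k : ℝ) : ℂ) * θ ξ)
        = (((N ((2 * Real.pi) • ξ) * M ((2 * Real.pi) • ξ)) i l : ℝ) : ℂ) * θ ξ := by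
      rw [Matrix.mul_apply, Complex.ofReal_sum, Finset.sum_mul]
      refine Finset.sum_congr rfl fun k _ ↦ ?_
      push_cast
      ring
    rw [h3, hNM, Matrix.one_apply]
    by_cases h : l = i
    · simp [h]
    · simp [h, Ne.symm h]
  simp_rw [h1]
  rw [Finset.sum_comm]
  simp_rw [← map_sum, h2]
  rw [Finset.sum_eq_single i (fun l _ hl ↦ by simp [hl]) (by simp)]
  simp

end Blocks

namespace IsDiffusiveSymbol

variable {d n : ℕ} {χ : Space d → ℝ} {α : ℝ} {c : Fin n → ℝ}
  {P S : Space d → Matrix (Fin n) (Fin n) ℝ}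

/-- The semigroup damps the frequencies of size `2^j` exponentially on the time scale
`2^{-2αj}`, and can be inverted there up to that time. -/
lemma exists_blockNorm_le (hd : 1 ≤ d) (hn : 1 ≤ n) (hχ : IsLPCutoff χ)
    (hS : IsDiffusiveSymbol α c P S) (p : ℝ≥0∞) [Fact (1 ≤ p)] {U₀ : Fin n → TDist d}
    {U : ℝ → Fin n → TDist d} (hU : IsSemigroupSolution S U₀ U) :
    ∃ C κ : ℝ, 0 < C ∧ 0 < κ ∧ ∀ t : ℝ, 0 < t → ∀ j : ℤ,
      blockNorm χ p (U t) j ≤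
        ENNReal.ofReal (C * Real.exp (-κ * (t * (2 : ℝ) ^ (2 * α * j)))) * blockNorm χ p U₀ j ∧
      (t * (2 : ℝ) ^ (2 * α * j) ≤ 1 →
        blockNorm χ p U₀ j ≤ ENNReal.ofReal C * blockNorm χ p (U t) j) := by
  obtain ⟨C, κ, hC, hκ, h⟩ := hS.exists_kernelNorm_dyadic_le hd hχ
  have hn0 : (0 : ℝ) < n := by exact_mod_cast hn
  refine ⟨n * (C * Real.exp κ), κ, by positivity, hκ, fun t ht j ↦ ⟨?_, fun htj ↦ ?_⟩⟩
  · have h0 : 0 < t * (2 : ℝ) ^ (2 * α * j) := by positivity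
    refine ((hU t ht).blockNorm_le hχ j (by positivity) (h t j (by linarith))).trans ?_
    refine mul_le_mul' (ENNReal.ofReal_le_ofReal ?_) le_rfl
    rw [← mul_assoc, ← mul_assoc]
    gcongr
    exact le_mul_of_one_le_right (by positivity) (Real.one_le_exp hκ.le)
  · have hinv : IsFourierMultiplier (fun ξ ↦ NormedSpace.exp ((-t) • S ξ)) (U t) U₀ := by
      refine (hU t ht).symm (fun i k ↦ ?_) fun ξ ↦ ?_
      · refine ContDiffOn.congr (f := fun ξ ↦ ∑ l ∈ Finset.univ.image c,
          Real.exp (-t * (l * ‖ξ‖ ^ (2 * α))) * spectralProj α c S l ξ i k) ?_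
          fun ξ hξ ↦ hS.exp_smul_symbol_apply hd t hξ i k
        exact ContDiffOn.sum fun l _ ↦ (Real.contDiff_exp.comp_contDiffOn
          (contDiffOn_const.mul (contDiffOn_const.mul (contDiffOn_norm_rpow _)))).mul
          (hS.contDiffOn_spectralProj l i k)
      · rw [← Matrix.exp_add_of_commute _ _ ((Commute.refl (S ξ)).smul_left _ |>.smul_right _),
          ← add_smul, neg_add_cancel, zero_smul, NormedSpace.exp_zero]
    refine (hinv.blockNorm_le hχ j (by positivity) (h (-t) j (by linarith))).trans ?_
    gcongr
    nlinarith

end IsDiffusiveSymbol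

/-! ### Sequence norms -/

section EllNorm

variable {r : ℝ≥0∞}

lemma ellNorm_mono {a b : ℤ → ℝ≥0∞} (h : ∀ j, a j ≤ b j) : ellNorm r a ≤ ellNorm r b := by
  unfold ellNorm
  split_ifs
  · exact iSup_mono h
  · have : 0 ≤ 1 / r.toReal := by positivity
    gcongr with j
    exact h j

lemma one_le_toReal (hr : 1 ≤ r) (hrt : r ≠ ⊤) : 1 ≤ r.toReal := by
  rw [← ENNReal.toReal_one]
  exact ENNReal.toReal_mono hrt hr

lemma le_ellNorm (hr : 1 ≤ r) (a : ℤ → ℝ≥0∞) (j : ℤ) : a j ≤ ellNorm r a := by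
  unfold ellNorm
  split_ifs with h
  · exact le_iSup a j
  · have hr1 := one_le_toReal hr h
    have hr0 : r.toReal ≠ 0 := by positivity
    calc a j = (a j ^ r.toReal) ^ (1 / r.toReal) := by
          rw [← ENNReal.rpow_mul, mul_one_div_cancel hr0, ENNReal.rpow_one]
      _ ≤ _ := by
          gcongr
          exact ENNReal.le_tsum j

lemma ellNorm_le_tsum (hr : 1 ≤ r) (a : ℤ → ℝ≥0∞) : ellNorm r a ≤ ∑' j, a j := by
  unfold ellNorm
  split_ifs with h
  · exact iSup_le fun j ↦ ENNReal.le_tsum j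
  · have hr1 := one_le_toReal hr h
    have hr0 : r.toReal ≠ 0 := by positivity
    set A := ∑' j, a j with hA
    rcases eq_or_ne A ⊤ with hAt | hAt
    · rw [hAt]
      exact le_top
    rcases eq_or_ne A 0 with hA0 | hA0
    · have h0 : ∀ j, a j = 0 := ENNReal.tsum_eq_zero.1 hA0
      simp [h0, zero_lt_one.trans_le hr1]
    have hle : ∀ j, a j ^ r.toReal ≤ a j * A ^ (r.toReal - 1) := fun j ↦ by
      have hj : a j ≤ A := ENNReal.le_tsum j
      rcases eq_or_ne (a j) 0 with h0 | h0
      · simp [h0, zero_lt_one.trans_le hr1]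
      calc a j ^ r.toReal = a j * a j ^ (r.toReal - 1) := by
            nth_rewrite 2 [← ENNReal.rpow_one (a j)]
            rw [← ENNReal.rpow_add _ _ h0 (ne_top_of_le_ne_top hAt hj)]
            simp
        _ ≤ _ := by
            have : 0 ≤ r.toReal - 1 := by linarith
            gcongr
    calc (∑' j, a j ^ r.toReal) ^ (1 / r.toReal)
        ≤ (∑' j, a j * A ^ (r.toReal - 1)) ^ (1 / r.toReal) := by
          gcongr with j
          exact hle j
      _ = (A ^ r.toReal) ^ (1 / r.toReal) := by
          rw [ENNReal.tsum_mul_right, ← hA]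
          congr 1
          nth_rewrite 1 [← ENNReal.rpow_one A]
          rw [← ENNReal.rpow_add _ _ hA0 hAt]
          simp
      _ = A := by rw [← ENNReal.rpow_mul, mul_one_div_cancel hr0, ENNReal.rpow_one]

lemma ellNorm_const_mul (hr : 1 ≤ r) (K : ℝ≥0∞) (a : ℤ → ℝ≥0∞) :
    ellNorm r (fun j ↦ K * a j) = K * ellNorm r a := by
  unfold ellNorm
  split_ifs with h
  · exact (ENNReal.mul_iSup _ _).symm
  · have hr1 := one_le_toReal hr h
    have hr0 : r.toReal ≠ 0 := by positivity
    simp_rw [ENNReal.mul_rpow_of_nonneg _ _ ENNReal.toReal_nonneg]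
    rw [ENNReal.tsum_mul_left, ENNReal.mul_rpow_of_nonneg _ _ (by positivity), ← ENNReal.rpow_mul,
      mul_one_div_cancel hr0, ENNReal.rpow_one]

lemma ellNorm_zero (hr : 1 ≤ r) : ellNorm r 0 = 0 := by
  simpa [Pi.zero_def] using ellNorm_const_mul hr 0 0

lemma ellNorm_add_le (hr : 1 ≤ r) (a b : ℤ → ℝ≥0∞) :
    ellNorm r (a + b) ≤ ellNorm r a + ellNorm r b := by
  unfold ellNorm
  split_ifs with h
  · exact iSup_le fun j ↦ add_le_add (le_iSup a j) (le_iSup b j)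
  · have h1 := ENNReal.lintegral_Lp_add_le (μ := Measure.count) (f := a) (g := b)
      (measurable_of_countable a).aemeasurable (measurable_of_countable b).aemeasurable
      (one_le_toReal hr h)
    simpa only [lintegral_count] using h1

lemma ellNorm_sum_le (hr : 1 ≤ r) {ι : Type*} (s : Finset ι) (a : ι → ℤ → ℝ≥0∞) :
    ellNorm r (∑ i ∈ s, a i) ≤ ∑ i ∈ s, ellNorm r (a i) :=
  Finset.le_sum_of_subadditive _ (ellNorm_zero hr).le (ellNorm_add_le hr) s a

/-- The weighted sequence norm `‖(2^{js} x_j)_j‖_{ℓ^r}`. -/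
def weightedNorm (r : ℝ≥0∞) (s : ℝ) (x : ℤ → ℝ≥0∞) : ℝ≥0∞ :=
  ellNorm r fun j ↦ (2 : ℝ≥0∞) ^ ((j : ℝ) * s) * x j

/-- The Besov norm of a vector, a sum of sequence norms, is equivalent to the sequence norm of the
summed blocks. -/
lemma besovNorm_le_weightedNorm {d n : ℕ} (χ : Space d → ℝ) (s : ℝ) (p r : ℝ≥0∞) [Fact (1 ≤ p)]
    (u : Fin n → TDist d) : besovNorm χ s p r u ≤ n * weightedNorm r s (blockNorm χ p u) := by
  calc besovNorm χ s p r u ≤ ∑ _i : Fin n, weightedNorm r s (blockNorm χ p u) := by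
        refine Finset.sum_le_sum fun i _ ↦ ellNorm_mono fun j ↦ ?_
        gcongr
        exact Finset.single_le_sum (f := fun i ↦ distLpNorm p (dyadicBlock χ j (u i)))
          (fun _ _ ↦ zero_le) (Finset.mem_univ i)
    _ = _ := by simp

lemma weightedNorm_le_besovNorm {d n : ℕ} (χ : Space d → ℝ) (s : ℝ) (p : ℝ≥0∞) {r : ℝ≥0∞}
    (hr : 1 ≤ r) [Fact (1 ≤ p)] (u : Fin n → TDist d) :
    weightedNorm r s (blockNorm χ p u) ≤ besovNorm χ s p r u := by
  refine le_of_eq_of_le ?_ (ellNorm_sum_le hr Finset.univ fun i j ↦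
    (2 : ℝ≥0∞) ^ ((j : ℝ) * s) * distLpNorm p (dyadicBlock χ j (u i)))
  unfold weightedNorm
  congr 1
  ext j
  rw [Finset.sum_apply, blockNorm, Finset.mul_sum]

lemma weightedNorm_top_le_iff {s : ℝ} {x : ℤ → ℝ≥0∞} {K : ℝ≥0∞} :
    weightedNorm ⊤ s x ≤ K ↔ ∀ j : ℤ, (2 : ℝ≥0∞) ^ ((j : ℝ) * s) * x j ≤ K := by
  simp [weightedNorm, ellNorm, iSup_le_iff]

lemma two_rpow_eq_ofReal (y : ℝ) : (2 : ℝ≥0∞) ^ y = ENNReal.ofReal ((2 : ℝ) ^ y) := by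
  rw [← ENNReal.ofReal_rpow_of_pos two_pos]
  simp

end EllNorm

/-! ### Decay rates of dyadically damped sequences -/

section Decay

/-- For `δ > 0`, the function `2^{δy} e^{-κ 2^{ηy}}` decays geometrically away from `y = 0`. -/
lemma exists_two_rpow_mul_exp_le (δ : ℝ) {κ η : ℝ} (hκ : 0 < κ) (hη : 0 < η) :
    ∃ G : ℝ, 0 < G ∧ ∀ y : ℝ,
      (2 : ℝ) ^ (δ * y) * Real.exp (-κ * (2 : ℝ) ^ (η * y)) ≤ G * (2 : ℝ) ^ (-δ * |y|) := by
  obtain ⟨N, hN⟩ := exists_nat_ge (2 * δ / η)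
  have hG : 0 < (N.factorial : ℝ) / κ ^ N := by positivity
  refine ⟨1 + N.factorial / κ ^ N, by positivity, fun y ↦ ?_⟩
  rcases le_total y 0 with hy | hy
  · rw [abs_of_nonpos hy, neg_mul_neg]
    have h1 : Real.exp (-κ * (2 : ℝ) ^ (η * y)) ≤ 1 := by
      rw [Real.exp_le_one_iff]
      have : 0 < κ * (2 : ℝ) ^ (η * y) := by positivity
      linarith
    have h2 : 0 < (2 : ℝ) ^ (δ * y) := by positivity
    nlinarith
  · rw [abs_of_nonneg hy]
    set z := (2 : ℝ) ^ (η * y) with hz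
    have hz1 : 1 ≤ z := Real.one_le_rpow one_le_two (by positivity)
    have h1 : (2 : ℝ) ^ (2 * δ * y) ≤ z ^ N := by
      rw [hz, ← Real.rpow_natCast, ← Real.rpow_mul two_pos.le]
      refine Real.rpow_le_rpow_of_exponent_le one_le_two ?_
      rw [div_le_iff₀ hη] at hN
      nlinarith
    have h2 : (κ * z) ^ N ≤ N.factorial * Real.exp (κ * z) := by
      have := Real.pow_div_factorial_le_exp (κ * z) (by positivity) N
      rwa [div_le_iff₀ (by positivity), mul_comm (Real.exp _)] at this
    have h3 : z ^ N * Real.exp (-κ * z) ≤ N.factorial / κ ^ N := by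
      rw [le_div_iff₀ (by positivity)]
      calc z ^ N * Real.exp (-κ * z) * κ ^ N = (κ * z) ^ N * Real.exp (-κ * z) := by
            rw [mul_pow]
            ring
        _ ≤ N.factorial * Real.exp (κ * z) * Real.exp (-κ * z) := by gcongr
        _ = N.factorial := by
            rw [mul_assoc, ← Real.exp_add]
            simp
    calc (2 : ℝ) ^ (δ * y) * Real.exp (-κ * z)
        = (2 : ℝ) ^ (-δ * y) * ((2 : ℝ) ^ (2 * δ * y) * Real.exp (-κ * z)) := by
          rw [← mul_assoc, ← Real.rpow_add two_pos]
          ring_nf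
      _ ≤ (2 : ℝ) ^ (-δ * y) * (z ^ N * Real.exp (-κ * z)) := by gcongr
      _ ≤ (2 : ℝ) ^ (-δ * y) * (1 + N.factorial / κ ^ N) := by
          gcongr
          linarith
      _ = _ := by ring

lemma tsum_two_rpow_neg_abs_ne_top {δ : ℝ} (hδ : 0 < δ) :
    ∑' j : ℤ, ENNReal.ofReal ((2 : ℝ) ^ (-δ * |(j : ℝ)|)) ≠ ⊤ := by
  refine Summable.tsum_ofReal_ne_top ?_
  have hq : (2 : ℝ) ^ (-δ) < 1 := Real.rpow_lt_one_of_one_lt_of_neg one_lt_two (by linarith)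
  have hs : Summable fun k : ℕ ↦ ((2 : ℝ) ^ (-δ)) ^ k :=
    summable_geometric_of_lt_one (by positivity) hq
  refine Summable.of_nat_of_neg ?_ ?_ <;>
  · refine hs.congr fun k ↦ ?_
    rw [← Real.rpow_natCast, ← Real.rpow_mul two_pos.le]
    simp

/-- If a convolution of a bounded sequence with a summable weight is bounded below at `m`, then
the sequence itself is bounded below within a fixed distance of `m`. -/
lemma exists_finset_le_of_le_tsum {w : ℤ → ℝ≥0∞} (hw : ∑' i, w i ≠ ⊤) {X : ℤ → ℝ≥0∞} {K : ℝ≥0∞}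
    (hK : K ≠ ⊤) (hX : ∀ j, X j ≤ K) {c : ℝ≥0∞} (hc : c ≠ 0) :
    ∃ (F : Finset ℤ) (c' : NNReal), 0 < c' ∧ ∀ m : ℤ, c ≤ ∑' i, w i * X (m + i) →
      ∃ i ∈ F, (c' : ℝ≥0∞) ≤ X (m + i) := by
  have hc2 : c / 2 ≠ 0 := by simpa using hc
  obtain ⟨ε, hε, hεK⟩ := ENNReal.exists_nnreal_pos_mul_lt hK hc2
  obtain ⟨F, hF⟩ := ((ENNReal.tendsto_tsum_compl_atTop_zero hw).eventually_lt_const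
    (ENNReal.coe_pos.2 hε)).exists
  obtain ⟨c', hc', hcw⟩ := ENNReal.exists_nnreal_pos_mul_lt hw hc2
  refine ⟨F, c', hc', fun m hm ↦ ?_⟩
  by_contra! hlt
  refine absurd hm (not_le.2 ?_)
  rw [← ENNReal.sum_add_tsum_compl F]
  calc _ ≤ ∑ i ∈ F, w i * c' + ∑' i : {x // x ∉ F}, w i * K := by
        refine add_le_add (Finset.sum_le_sum fun i hi ↦ ?_) (ENNReal.tsum_le_tsum fun i ↦ ?_)
        · have := (hlt i hi).le
          gcongr
        · have := hX (m + i)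
          gcongr
    _ ≤ (∑' i, w i) * c' + ε * K := by
        rw [← Finset.sum_mul, ENNReal.tsum_mul_right]
        gcongr
        exact ENNReal.sum_le_tsum F
    _ < c / 2 + c / 2 := by
        rw [mul_comm _ (c' : ℝ≥0∞)]
        exact ENNReal.add_lt_add hcw hεK
    _ = c := ENNReal.add_halves c

variable {r : ℝ≥0∞} {σ σ₁ α C κ : ℝ} {x : ℤ → ℝ≥0∞} {y : ℝ → ℤ → ℝ≥0∞}

/-- At time `t = 2^{-2αs}` the damped sequence is concentrated around the index `s`. -/
lemma exists_two_rpow_mul_damped_le (hα : 0 < α) (hC : 0 < C) (hκ : 0 < κ)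
    (hy : ∀ t : ℝ, 0 < t → ∀ j : ℤ,
      y t j ≤ ENNReal.ofReal (C * Real.exp (-κ * (t * (2 : ℝ) ^ (2 * α * j)))) * x j) :
    ∃ B : ℝ, 0 < B ∧ ∀ (s : ℝ) (j : ℤ),
      (2 : ℝ≥0∞) ^ ((j : ℝ) * σ) * y ((2 : ℝ) ^ (-(2 * α * s))) j ≤
        ENNReal.ofReal (B * (2 : ℝ) ^ ((σ - σ₁) * s)) *
          (ENNReal.ofReal ((2 : ℝ) ^ (-(σ - σ₁) * |j - s|)) *
            ((2 : ℝ≥0∞) ^ ((j : ℝ) * σ₁) * x j)) := by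
  obtain ⟨G, hG, hGy⟩ := exists_two_rpow_mul_exp_le (σ - σ₁) hκ (η := 2 * α) (by positivity)
  refine ⟨C * G, by positivity, fun s j ↦ ?_⟩
  have h1 : (2 : ℝ) ^ (-(2 * α * s)) * (2 : ℝ) ^ (2 * α * j) = (2 : ℝ) ^ (2 * α * (j - s)) := by
    rw [← Real.rpow_add two_pos]
    ring_nf
  have h2 : (2 : ℝ) ^ ((j : ℝ) * σ) = (2 : ℝ) ^ ((σ - σ₁) * s) *
      (2 : ℝ) ^ ((σ - σ₁) * (j - s)) * (2 : ℝ) ^ ((j : ℝ) * σ₁) := by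
    rw [← Real.rpow_add two_pos, ← Real.rpow_add two_pos]
    ring_nf
  have h3 := hy _ (by positivity : (0 : ℝ) < (2 : ℝ) ^ (-(2 * α * s))) j
  rw [h1] at h3
  rw [two_rpow_eq_ofReal, two_rpow_eq_ofReal]
  calc _ ≤ ENNReal.ofReal ((2 : ℝ) ^ ((j : ℝ) * σ)) *
        (ENNReal.ofReal (C * Real.exp (-κ * (2 : ℝ) ^ (2 * α * (j - s)))) * x j) := by gcongr
    _ = ENNReal.ofReal ((2 : ℝ) ^ ((j : ℝ) * σ) *
        (C * Real.exp (-κ * (2 : ℝ) ^ (2 * α * (j - s))))) * x j := by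
        rw [← mul_assoc, ← ENNReal.ofReal_mul (by positivity)]
    _ ≤ ENNReal.ofReal (C * G * (2 : ℝ) ^ ((σ - σ₁) * s) *
        ((2 : ℝ) ^ (-(σ - σ₁) * |j - s|) * (2 : ℝ) ^ ((j : ℝ) * σ₁))) * x j := by
        gcongr ENNReal.ofReal ?_ * _
        calc _ = C * (2 : ℝ) ^ ((σ - σ₁) * s) * (2 : ℝ) ^ ((j : ℝ) * σ₁) *
              ((2 : ℝ) ^ ((σ - σ₁) * (j - s)) *
                Real.exp (-κ * (2 : ℝ) ^ (2 * α * (j - s)))) := by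
              rw [h2]
              ring
          _ ≤ C * (2 : ℝ) ^ ((σ - σ₁) * s) * (2 : ℝ) ^ ((j : ℝ) * σ₁) *
              (G * (2 : ℝ) ^ (-(σ - σ₁) * |j - s|)) :=
              mul_le_mul_of_nonneg_left (hGy _) (by positivity)
          _ = _ := by ring
    _ = _ := by
        rw [ENNReal.ofReal_mul (p := C * G * (2 : ℝ) ^ ((σ - σ₁) * s)) (by positivity),
          ENNReal.ofReal_mul (p := (2 : ℝ) ^ (-(σ - σ₁) * |j - s|)) (by positivity)]
        simp only [mul_assoc]

lemma eq_two_rpow_of_pos (hα : 0 < α) {t : ℝ} (ht : 0 < t) :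
    t = (2 : ℝ) ^ (-(2 * α * (-Real.logb 2 t / (2 * α)))) := by
  rw [mul_div_cancel₀ _ (by positivity), neg_neg, Real.rpow_logb two_pos (by norm_num) ht]

/-- Bounded low frequencies of order `σ₁` give the decay rate of order `σ - σ₁`. -/
lemma weightedNorm_damped_le (hr : 1 ≤ r) (hα : 0 < α) (hσ : σ₁ < σ) (hC : 0 < C) (hκ : 0 < κ)
    (hy : ∀ t : ℝ, 0 < t → ∀ j : ℤ,
      y t j ≤ ENNReal.ofReal (C * Real.exp (-κ * (t * (2 : ℝ) ^ (2 * α * j)))) * x j)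
    (hx : weightedNorm r σ x < ⊤) (hx₁ : weightedNorm ⊤ σ₁ x < ⊤) :
    ∃ C' : ℝ, 0 < C' ∧ ∀ t : ℝ, 0 < t → weightedNorm r σ (y t) ≤
      ENNReal.ofReal (C' * (1 + t) ^ (-(σ - σ₁) / (2 * α))) := by
  have hδ : 0 < σ - σ₁ := sub_pos.2 hσ
  obtain ⟨B, hB, hBy⟩ := exists_two_rpow_mul_damped_le (σ := σ) (σ₁ := σ₁) hα hC hκ hy
  set W := ∑' j : ℤ, ENNReal.ofReal ((2 : ℝ) ^ (-(σ - σ₁) * |(j : ℝ)|)) with hW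
  have hWt : W ≠ ⊤ := tsum_two_rpow_neg_abs_ne_top hδ
  set K := weightedNorm ⊤ σ₁ x with hK
  have hKx : ∀ j : ℤ, (2 : ℝ≥0∞) ^ ((j : ℝ) * σ₁) * x j ≤ K := weightedNorm_top_le_iff.1 le_rfl
  set β := (σ - σ₁) / (2 * α) with hβ
  have hβ0 : 0 < β := by positivity
  -- Rounding `s` to an integer costs a factor `2^δ`.
  have hlarge : ∀ t : ℝ, 0 < t → weightedNorm r σ (y t) ≤
      ENNReal.ofReal (B * t ^ (-β)) * (ENNReal.ofReal ((2 : ℝ) ^ (σ - σ₁)) * W * K) := by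
    intro t ht
    obtain ⟨s, hs⟩ : ∃ s : ℝ, t = (2 : ℝ) ^ (-(2 * α * s)) := ⟨_, eq_two_rpow_of_pos hα ht⟩
    have hts : t ^ (-β) = (2 : ℝ) ^ ((σ - σ₁) * s) := by
      rw [hs, ← Real.rpow_mul two_pos.le, hβ]
      congr 1
      field_simp
    refine (ellNorm_le_tsum hr _).trans ?_
    rw [hts]
    calc ∑' j : ℤ, (2 : ℝ≥0∞) ^ ((j : ℝ) * σ) * y t j
        ≤ ∑' j : ℤ, ENNReal.ofReal (B * (2 : ℝ) ^ ((σ - σ₁) * s)) *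
            (ENNReal.ofReal ((2 : ℝ) ^ (σ - σ₁)) *
              ENNReal.ofReal ((2 : ℝ) ^ (-(σ - σ₁) * |((j - ⌊s⌋ : ℤ) : ℝ)|)) * K) := by
          refine ENNReal.tsum_le_tsum fun j ↦ ?_
          rw [hs]
          refine (hBy s j).trans ?_
          have h1 : |((j - ⌊s⌋ : ℤ) : ℝ)| - 1 ≤ |j - s| := by
            have h2 : |((j - ⌊s⌋ : ℤ) : ℝ)| ≤ |j - s| + |s - ⌊s⌋| := by
              push_cast
              exact abs_sub_le _ _ _
            have h3 : |s - ⌊s⌋| ≤ 1 := by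
              rw [Int.self_sub_floor, abs_of_nonneg (Int.fract_nonneg s)]
              exact (Int.fract_lt_one s).le
            linarith
          have h4 : (2 : ℝ) ^ (-(σ - σ₁) * |j - s|) ≤
              (2 : ℝ) ^ (σ - σ₁) * (2 : ℝ) ^ (-(σ - σ₁) * |((j - ⌊s⌋ : ℤ) : ℝ)|) := by
            rw [← Real.rpow_add two_pos]
            refine Real.rpow_le_rpow_of_exponent_le one_le_two ?_
            nlinarith
          rw [← ENNReal.ofReal_mul (p := (2 : ℝ) ^ (σ - σ₁)) (by positivity)]
          have h5 := hKx j
          gcongr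
      _ = _ := by
          rw [ENNReal.tsum_mul_left, ENNReal.tsum_mul_right, ENNReal.tsum_mul_left, hW,
            ← (Equiv.subRight ⌊s⌋).tsum_eq fun j : ℤ ↦
              ENNReal.ofReal ((2 : ℝ) ^ (-(σ - σ₁) * |(j : ℝ)|))]
          rfl
  have hsmall : ∀ t : ℝ, 0 < t → weightedNorm r σ (y t) ≤
      ENNReal.ofReal C * weightedNorm r σ x := by
    intro t ht
    unfold weightedNorm
    rw [← ellNorm_const_mul hr]
    refine ellNorm_mono fun j ↦ ?_
    rw [mul_left_comm]
    gcongr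
    refine (hy t ht j).trans ?_
    gcongr
    have h1 : Real.exp (-κ * (t * (2 : ℝ) ^ (2 * α * j))) ≤ 1 := by
      rw [Real.exp_le_one_iff]
      have : 0 < κ * (t * (2 : ℝ) ^ (2 * α * j)) := by positivity
      linarith
    exact mul_le_of_le_one_right hC.le h1
  obtain ⟨A₁, hA₁, hA₁e⟩ : ∃ A : ℝ, 0 ≤ A ∧
      ENNReal.ofReal ((2 : ℝ) ^ (σ - σ₁)) * W * K = ENNReal.ofReal A :=
    ⟨_, ENNReal.toReal_nonneg, (ENNReal.ofReal_toReal
      (ENNReal.mul_ne_top (ENNReal.mul_ne_top ENNReal.ofReal_ne_top hWt) hx₁.ne)).symm⟩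
  obtain ⟨A₂, hA₂, hA₂e⟩ : ∃ A : ℝ, 0 ≤ A ∧ weightedNorm r σ x = ENNReal.ofReal A :=
    ⟨_, ENNReal.toReal_nonneg, (ENNReal.ofReal_toReal hx.ne).symm⟩
  rw [hA₁e] at hlarge
  rw [hA₂e] at hsmall
  refine ⟨(2 : ℝ) ^ β * (B * A₁ + C * A₂ + 1), by positivity, fun t ht ↦ ?_⟩
  rw [neg_div, ← hβ]
  -- The bound for `t ≥ 1` is that of `hlarge`, the one for `t ≤ 1` that of `hsmall`.
  have h2 : ∀ v : ℝ, 0 < v → 1 + t ≤ 2 * v → v ^ (-β) ≤ (2 : ℝ) ^ β * (1 + t) ^ (-β) := by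
    intro v hv htv
    have h3 : (2 * v) ^ (-β) ≤ (1 + t) ^ (-β) :=
      Real.rpow_le_rpow_of_nonpos (by positivity) htv (by linarith)
    calc v ^ (-β) = (2 : ℝ) ^ β * (2 * v) ^ (-β) := by
          rw [Real.mul_rpow two_pos.le hv.le, ← mul_assoc, ← Real.rpow_add two_pos]
          simp
      _ ≤ _ := by gcongr
  have hp : 0 < (2 : ℝ) ^ β * (1 + t) ^ (-β) := by positivity
  rcases le_total 1 t with h | h
  · refine (hlarge t ht).trans ?_
    rw [← ENNReal.ofReal_mul (by positivity)]
    refine ENNReal.ofReal_le_ofReal ?_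
    calc B * t ^ (-β) * A₁ = B * A₁ * t ^ (-β) := by ring
      _ ≤ (B * A₁ + C * A₂ + 1) * ((2 : ℝ) ^ β * (1 + t) ^ (-β)) := by
        gcongr
        · have : 0 ≤ C * A₂ := by positivity
          linarith
        · exact h2 t ht (by linarith)
      _ = _ := by ring
  · refine (hsmall t ht).trans ?_
    rw [← ENNReal.ofReal_mul (by positivity)]
    refine ENNReal.ofReal_le_ofReal ?_
    have h3 := h2 1 one_pos (by linarith)
    rw [Real.one_rpow] at h3
    calc C * A₂ = C * A₂ * 1 := (mul_one _).symm
      _ ≤ (B * A₁ + C * A₂ + 1) * ((2 : ℝ) ^ β * (1 + t) ^ (-β)) := by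
        gcongr
        have : 0 ≤ B * A₁ := by positivity
        linarith
      _ = _ := by ring

/-- The decay rate bounds the block `j` of the initial sequence, as is seen at the time
`t = 2^{-2αj}`. -/
lemma weightedNorm_lt_top_of_damped_le (hr : 1 ≤ r) (hα : 0 < α) (hσ : σ₁ < σ)
    (hxy : ∀ t : ℝ, 0 < t → ∀ j : ℤ, t * (2 : ℝ) ^ (2 * α * j) ≤ 1 →
      x j ≤ ENNReal.ofReal C * y t j) {C' : ℝ} (hC' : 0 < C')
    (h : ∀ t : ℝ, 0 < t → weightedNorm r σ (y t) ≤
      ENNReal.ofReal (C' * (1 + t) ^ (-(σ - σ₁) / (2 * α)))) :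
    weightedNorm ⊤ σ₁ x < ⊤ := by
  have hδ : 0 < σ - σ₁ := sub_pos.2 hσ
  refine (weightedNorm_top_le_iff.2 fun j ↦ ?_ :
    _ ≤ ENNReal.ofReal C * ENNReal.ofReal C').trans_lt
      (ENNReal.mul_lt_top ENNReal.ofReal_lt_top ENNReal.ofReal_lt_top)
  set t : ℝ := (2 : ℝ) ^ (-(2 * α * j)) with ht
  have ht0 : 0 < t := by positivity
  have htj : t * (2 : ℝ) ^ (2 * α * j) = 1 := by
    rw [ht, ← Real.rpow_add two_pos, neg_add_cancel, Real.rpow_zero]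
  have h1 : (1 + t) ^ (-(σ - σ₁) / (2 * α)) ≤ (2 : ℝ) ^ ((j : ℝ) * (σ - σ₁)) := by
    calc (1 + t) ^ (-(σ - σ₁) / (2 * α)) ≤ t ^ (-(σ - σ₁) / (2 * α)) := by
          refine Real.rpow_le_rpow_of_nonpos ht0 (by linarith) ?_
          rw [neg_div]
          have : 0 < (σ - σ₁) / (2 * α) := by positivity
          linarith
      _ = _ := by
          rw [ht, ← Real.rpow_mul two_pos.le]
          congr 1
          field_simp
  have h2 : (2 : ℝ≥0∞) ^ ((j : ℝ) * σ₁) =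
      (2 : ℝ≥0∞) ^ (-((j : ℝ) * (σ - σ₁))) * (2 : ℝ≥0∞) ^ ((j : ℝ) * σ) := by
    rw [← ENNReal.rpow_add _ _ two_ne_zero ENNReal.ofNat_ne_top]
    ring_nf
  calc (2 : ℝ≥0∞) ^ ((j : ℝ) * σ₁) * x j
      ≤ (2 : ℝ≥0∞) ^ ((j : ℝ) * σ₁) * (ENNReal.ofReal C * y t j) := by
        gcongr
        exact hxy t ht0 j htj.le
    _ = ENNReal.ofReal C * ((2 : ℝ≥0∞) ^ (-((j : ℝ) * (σ - σ₁))) *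
          ((2 : ℝ≥0∞) ^ ((j : ℝ) * σ) * y t j)) := by
        rw [h2]
        ring
    _ ≤ ENNReal.ofReal C * ((2 : ℝ≥0∞) ^ (-((j : ℝ) * (σ - σ₁))) *
          ENNReal.ofReal (C' * (2 : ℝ) ^ ((j : ℝ) * (σ - σ₁)))) := by
        gcongr
        refine (le_ellNorm hr (fun j : ℤ ↦ (2 : ℝ≥0∞) ^ ((j : ℝ) * σ) * y t j) j).trans
          ((h t ht0).trans ?_)
        gcongr
    _ = _ := by
        rw [two_rpow_eq_ofReal, ← ENNReal.ofReal_mul (by positivity), mul_left_comm,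
          ← Real.rpow_add two_pos, neg_add_cancel, Real.rpow_zero, mul_one]

/-- Large blocks at indices with bounded gaps give a lower bound for the decay: at time `t` one of
them lies at a bounded distance below `-log₂(1 + t) / (2α)`, where it has not yet been damped. -/
lemma exists_le_weightedNorm_damped (hr : 1 ≤ r) (hα : 0 < α) (hσ : σ₁ < σ) (hC : 0 < C)
    (hxy : ∀ t : ℝ, 0 < t → ∀ j : ℤ, t * (2 : ℝ) ^ (2 * α * j) ≤ 1 →
      x j ≤ ENNReal.ofReal C * y t j) {c M : ℝ} (hc : 0 < c) {j : ℕ → ℤ}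
    (hj : Tendsto j atTop atBot) (hM : ∀ k, |(j k : ℝ) - (j (k + 1) : ℝ)| ≤ M)
    (hcj : ∀ k, ENNReal.ofReal c ≤ (2 : ℝ≥0∞) ^ (σ₁ * (j k : ℝ)) * x (j k)) :
    ∃ c' : ℝ, 0 < c' ∧ ∀ t : ℝ, 0 < t →
      ENNReal.ofReal (c' * (1 + t) ^ (-(σ - σ₁) / (2 * α))) ≤ weightedNorm r σ (y t) := by
  have hδ : 0 < σ - σ₁ := sub_pos.2 hσ
  set M' := max M |(j 0 : ℝ)| with hM'
  refine ⟨C⁻¹ * (c * (2 : ℝ) ^ (-(σ - σ₁) * M')), by positivity, fun t ht ↦ ?_⟩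
  set J : ℝ := -Real.logb 2 (1 + t) / (2 * α) with hJ
  have hJt : 1 + t = (2 : ℝ) ^ (-(2 * α * J)) := eq_two_rpow_of_pos hα (by linarith)
  have hJ0 : J ≤ 0 := by
    have : 0 ≤ Real.logb 2 (1 + t) := Real.logb_nonneg one_lt_two (by linarith)
    exact div_nonpos_of_nonpos_of_nonneg (by linarith) (by linarith)
  -- The first index below `J` is within distance `M'` of `J`.
  obtain ⟨k, hk, hk'⟩ : ∃ k, (j k : ℝ) ≤ J ∧ J - M' ≤ j k := by
    have hex : ∃ k, (j k : ℝ) ≤ J := by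
      obtain ⟨k, hk⟩ := (hj.eventually_le_atBot ⌊J⌋).exists
      exact ⟨k, (Int.cast_le.2 hk).trans (Int.floor_le J)⟩
    classical
    refine ⟨Nat.find hex, Nat.find_spec hex, ?_⟩
    rcases hk : Nat.find hex with _ | k
    · have := neg_abs_le (j 0 : ℝ)
      have := le_max_right M |(j 0 : ℝ)|
      linarith
    · have h1 : J < j k := not_le.1 (Nat.find_min hex (by omega : k < Nat.find hex))
      have h2 := (le_abs_self _).trans (hM k)
      have := le_max_left M |(j 0 : ℝ)|
      linarith
  have htk : t * (2 : ℝ) ^ (2 * α * j k) ≤ 1 := by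
    calc t * (2 : ℝ) ^ (2 * α * j k) ≤ (1 + t) * (2 : ℝ) ^ (2 * α * J) := by
          gcongr
          · linarith
          · exact one_le_two
      _ = 1 := by rw [hJt, ← Real.rpow_add two_pos, neg_add_cancel, Real.rpow_zero]
  refine le_trans ?_ (le_ellNorm hr (fun j : ℤ ↦ (2 : ℝ≥0∞) ^ ((j : ℝ) * σ) * y t j) (j k))
  have h1 : (1 + t) ^ (-(σ - σ₁) / (2 * α)) = (2 : ℝ) ^ ((σ - σ₁) * J) := by
    rw [hJt, ← Real.rpow_mul two_pos.le]
    congr 1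
    field_simp
  have h2 : (2 : ℝ≥0∞) ^ ((j k : ℝ) * σ) =
      (2 : ℝ≥0∞) ^ ((σ - σ₁) * j k) * (2 : ℝ≥0∞) ^ (σ₁ * (j k : ℝ)) := by
    rw [← ENNReal.rpow_add _ _ two_ne_zero ENNReal.ofNat_ne_top]
    ring_nf
  have h3 : (2 : ℝ) ^ (-(σ - σ₁) * M') * (2 : ℝ) ^ ((σ - σ₁) * J) ≤
      (2 : ℝ) ^ ((σ - σ₁) * j k) := by
    rw [← Real.rpow_add two_pos]
    refine Real.rpow_le_rpow_of_exponent_le one_le_two ?_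
    nlinarith
  have h4 : ENNReal.ofReal (C⁻¹) * x (j k) ≤ y t (j k) := by
    calc _ ≤ ENNReal.ofReal (C⁻¹) * (ENNReal.ofReal C * y t (j k)) := by
          gcongr
          exact hxy t ht _ htk
      _ = _ := by
          rw [← mul_assoc, ← ENNReal.ofReal_mul (by positivity), inv_mul_cancel₀ hC.ne',
            ENNReal.ofReal_one, one_mul]
  calc _ ≤ ENNReal.ofReal (C⁻¹ * ((2 : ℝ) ^ ((σ - σ₁) * j k) * c)) := by
        refine ENNReal.ofReal_le_ofReal ?_
        rw [h1]
        calc _ = C⁻¹ * (((2 : ℝ) ^ (-(σ - σ₁) * M') * (2 : ℝ) ^ ((σ - σ₁) * J)) * c) := by ring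
          _ ≤ _ := by gcongr
    _ = ENNReal.ofReal (C⁻¹) * ((2 : ℝ≥0∞) ^ ((σ - σ₁) * j k) * ENNReal.ofReal c) := by
        rw [two_rpow_eq_ofReal, ENNReal.ofReal_mul (by positivity),
          ENNReal.ofReal_mul (by positivity)]
    _ ≤ ENNReal.ofReal (C⁻¹) * ((2 : ℝ≥0∞) ^ ((σ - σ₁) * j k) *
          ((2 : ℝ≥0∞) ^ (σ₁ * (j k : ℝ)) * x (j k))) := by
        gcongr
        exact hcj k
    _ = (2 : ℝ≥0∞) ^ ((j k : ℝ) * σ) * (ENNReal.ofReal (C⁻¹) * x (j k)) := by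
        rw [h2]
        ring
    _ ≤ _ := by gcongr

/-- A lower bound for the decay forces large blocks at indices with bounded gaps. -/
lemma exists_lower_indices_of_le_damped (hr : 1 ≤ r) (hα : 0 < α) (hσ : σ₁ < σ) (hC : 0 < C)
    (hκ : 0 < κ)
    (hy : ∀ t : ℝ, 0 < t → ∀ j : ℤ,
      y t j ≤ ENNReal.ofReal (C * Real.exp (-κ * (t * (2 : ℝ) ^ (2 * α * j)))) * x j)
    (hx₁ : weightedNorm ⊤ σ₁ x < ⊤) {c : ℝ} (hc : 0 < c)
    (h : ∀ t : ℝ, 0 < t →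
      ENNReal.ofReal (c * (1 + t) ^ (-(σ - σ₁) / (2 * α))) ≤ weightedNorm r σ (y t)) :
    ∃ (c' M : ℝ) (j : ℕ → ℤ), 0 < c' ∧ 0 < M ∧ Tendsto j atTop atBot ∧
      (∀ k, |(j k : ℝ) - (j (k + 1) : ℝ)| ≤ M) ∧
      ∀ k, ENNReal.ofReal c' ≤ (2 : ℝ≥0∞) ^ (σ₁ * (j k : ℝ)) * x (j k) := by
  have hδ : 0 < σ - σ₁ := sub_pos.2 hσ
  obtain ⟨B, hB, hBy⟩ := exists_two_rpow_mul_damped_le (σ := σ) (σ₁ := σ₁) hα hC hκ hy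
  have hKx : ∀ j : ℤ, (2 : ℝ≥0∞) ^ ((j : ℝ) * σ₁) * x j ≤ weightedNorm ⊤ σ₁ x :=
    weightedNorm_top_le_iff.1 le_rfl
  set X : ℤ → ℝ≥0∞ := fun j ↦ (2 : ℝ≥0∞) ^ ((j : ℝ) * σ₁) * x j with hX
  set β := (σ - σ₁) / (2 * α) with hβ
  have hβ0 : 0 < β := by positivity
  obtain ⟨F, c', hc', hF⟩ := exists_finset_le_of_le_tsum (tsum_two_rpow_neg_abs_ne_top hδ)
    hx₁.ne hKx (c := ENNReal.ofReal (B⁻¹ * (c * (2 : ℝ) ^ (-β))))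
    (by simp only [ne_eq, ENNReal.ofReal_eq_zero, not_le]; positivity)
  -- At time `2^{-2αm} ≥ 1`, only the indices close to `m` matter.
  have hm : ∀ m : ℤ, m ≤ 0 → ∃ i ∈ F, (c' : ℝ≥0∞) ≤ X (m + i) := fun m hm ↦ hF m <| by
    have hm' : (m : ℝ) ≤ 0 := by exact_mod_cast hm
    set t : ℝ := (2 : ℝ) ^ (-(2 * α * m)) with ht
    have ht0 : 0 < t := by positivity
    have ht1 : 1 ≤ t := Real.one_le_rpow one_le_two (by nlinarith)
    have h1 : (2 : ℝ) ^ (-β) * (2 : ℝ) ^ ((σ - σ₁) * m) ≤ (1 + t) ^ (-(σ - σ₁) / (2 * α)) := by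
      calc _ = (2 : ℝ) ^ (-β) * t ^ (-β) := by
            rw [ht, ← Real.rpow_mul two_pos.le (-(2 * α * (m : ℝ)))]
            congr 2
            rw [hβ]
            field_simp
        _ = (2 * t) ^ (-β) := (Real.mul_rpow two_pos.le ht0.le).symm
        _ ≤ (1 + t) ^ (-β) :=
            Real.rpow_le_rpow_of_nonpos (by positivity) (by linarith) (by linarith)
        _ = _ := by rw [neg_div]
    have h2 : ENNReal.ofReal (c * ((2 : ℝ) ^ (-β) * (2 : ℝ) ^ ((σ - σ₁) * m))) ≤
        ENNReal.ofReal (B * (2 : ℝ) ^ ((σ - σ₁) * m)) *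
          ∑' i : ℤ, ENNReal.ofReal ((2 : ℝ) ^ (-(σ - σ₁) * |(i : ℝ)|)) * X (m + i) := by
      calc _ ≤ weightedNorm r σ (y t) := le_trans (by gcongr) (h t ht0)
        _ ≤ ∑' j : ℤ, ENNReal.ofReal (B * (2 : ℝ) ^ ((σ - σ₁) * m)) *
            (ENNReal.ofReal ((2 : ℝ) ^ (-(σ - σ₁) * |(j : ℝ) - m|)) * X j) :=
            (ellNorm_le_tsum hr _).trans (ENNReal.tsum_le_tsum fun j ↦ hBy m j)
        _ = _ := by
            rw [ENNReal.tsum_mul_left, ← (Equiv.addLeft m).tsum_eq]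
            simp
    have h3 : 0 < (2 : ℝ) ^ ((σ - σ₁) * m) := by positivity
    calc _ = ENNReal.ofReal ((B * (2 : ℝ) ^ ((σ - σ₁) * m))⁻¹) *
          ENNReal.ofReal (c * ((2 : ℝ) ^ (-β) * (2 : ℝ) ^ ((σ - σ₁) * m))) := by
          rw [← ENNReal.ofReal_mul (by positivity)]
          congr 1
          field_simp
      _ ≤ ENNReal.ofReal ((B * (2 : ℝ) ^ ((σ - σ₁) * m))⁻¹) *
          (ENNReal.ofReal (B * (2 : ℝ) ^ ((σ - σ₁) * m)) * _) := by gcongr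
      _ = _ := by
          rw [← mul_assoc, ← ENNReal.ofReal_mul (by positivity), inv_mul_cancel₀ (by positivity),
            ENNReal.ofReal_one, one_mul]
  choose! i hiF hi using hm
  obtain ⟨N, hN⟩ := (F.image fun i : ℤ ↦ |(i : ℝ)|).exists_le
  have hNi : ∀ m : ℤ, m ≤ 0 → |(i m : ℝ)| ≤ N := fun m hm ↦
    hN _ (Finset.mem_image_of_mem _ (hiF m hm))
  have hk : ∀ k : ℕ, -(k : ℤ) ≤ 0 := fun k ↦ by omega
  have hN0 : 0 ≤ N := (abs_nonneg _).trans (hNi 0 le_rfl)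
  refine ⟨c', 1 + 2 * N, fun k ↦ -(k : ℤ) + i (-k), by exact_mod_cast hc', by linarith, ?_,
    fun k ↦ ?_, fun k ↦ ?_⟩
  · have hle : ∀ k : ℕ, -(k : ℤ) + i (-k) ≤ -(k : ℤ) + ⌈N⌉ := fun k ↦ by
      have h1 : (i (-k) : ℝ) ≤ (⌈N⌉ : ℝ) :=
        (le_abs_self _).trans ((hNi _ (hk k)).trans (Int.le_ceil N))
      have h2 : i (-k) ≤ ⌈N⌉ := by exact_mod_cast h1
      linarith
    exact tendsto_atBot_mono hle (tendsto_atBot_add_const_right _ _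
      (tendsto_neg_atTop_atBot.comp tendsto_natCast_atTop_atTop))
  · have h1 := abs_le.1 (hNi _ (hk k))
    have h2 := abs_le.1 (hNi _ (hk (k + 1)))
    push_cast at h2 ⊢
    rw [abs_le]
    constructor <;> linarith [h1.1, h1.2, h2.1, h2.2]
  · rw [ENNReal.ofReal_coe_nnreal, mul_comm σ₁]
    exact hi _ (hk k)

end Decay

end

theorem proposition3p1 {d n : ℕ} (hd : 1 ≤ d) (hn : 1 ≤ n)
    (χ : Space d → ℝ) (hχ : IsLPCutoff χ)
    (α : ℝ) (c : Fin n → ℝ) (P S : Space d → Matrix (Fin n) (Fin n) ℝ)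
    (hS : IsDiffusiveSymbol α c P S)
    (p r : ℝ≥0∞) [Fact (1 ≤ p)] (hr : 1 ≤ r) (σ σ₁ : ℝ) (hσ : σ₁ < σ)
    (U₀ : Fin n → TDist d) (hU₀ : MemBesov χ σ p r U₀)
    (U : ℝ → Fin n → TDist d) (hU : IsSemigroupSolution S U₀ U) :
    ((∃ C : ℝ, 0 < C ∧ ∀ t : ℝ, 0 < t →
        besovNorm χ σ p r (U t) ≤ ENNReal.ofReal (C * (1 + t) ^ (-(σ - σ₁) / (2 * α)))) ↔
      MemBesov χ σ₁ p ⊤ U₀) ∧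
    ((∃ c₀ C : ℝ, 0 < c₀ ∧ 0 < C ∧ ∀ t : ℝ, 0 < t →
        ENNReal.ofReal (c₀ * (1 + t) ^ (-(σ - σ₁) / (2 * α))) ≤ besovNorm χ σ p r (U t) ∧
        besovNorm χ σ p r (U t) ≤ ENNReal.ofReal (C * (1 + t) ^ (-(σ - σ₁) / (2 * α)))) ↔
      MemBesovLower χ σ₁ p U₀) := by
  obtain ⟨C, κ, hC, hκ, h⟩ := hS.exists_blockNorm_le hd hn hχ p hU
  have hα := hS.order_pos
  have hy := fun t ht j ↦ (h t ht j).1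
  have hxy : ∀ t : ℝ, 0 < t → ∀ j : ℤ, t * (2 : ℝ) ^ (2 * α * j) ≤ 1 →
      blockNorm χ p U₀ j ≤ ENNReal.ofReal C * blockNorm χ p (U t) j := fun t ht j ↦ (h t ht j).2
  have hn0 : (0 : ℝ) < n := by exact_mod_cast hn
  have hx : weightedNorm r σ (blockNorm χ p U₀) < ⊤ :=
    (weightedNorm_le_besovNorm χ σ p hr U₀).trans_lt hU₀
  have hmem : MemBesov χ σ₁ p ⊤ U₀ ↔ weightedNorm ⊤ σ₁ (blockNorm χ p U₀) < ⊤ :=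
    ⟨(weightedNorm_le_besovNorm χ σ₁ p le_top U₀).trans_lt, fun h ↦
      (besovNorm_le_weightedNorm χ σ₁ p ⊤ U₀).trans_lt
        (ENNReal.mul_lt_top (ENNReal.natCast_lt_top n) h)⟩
  have hupper : (∃ C : ℝ, 0 < C ∧ ∀ t : ℝ, 0 < t →
      besovNorm χ σ p r (U t) ≤ ENNReal.ofReal (C * (1 + t) ^ (-(σ - σ₁) / (2 * α)))) ↔
      MemBesov χ σ₁ p ⊤ U₀ := by
    rw [hmem]
    constructor
    · rintro ⟨C', hC', hb⟩
      exact weightedNorm_lt_top_of_damped_le hr hα hσ hxy hC' fun t ht ↦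
        (weightedNorm_le_besovNorm χ σ p hr (U t)).trans (hb t ht)
    · intro hx₁
      obtain ⟨C', hC', hb⟩ := weightedNorm_damped_le hr hα hσ hC hκ hy hx hx₁
      refine ⟨n * C', by positivity, fun t ht ↦ (besovNorm_le_weightedNorm χ σ p r (U t)).trans ?_⟩
      rw [mul_assoc, ENNReal.ofReal_mul hn0.le, ENNReal.ofReal_natCast]
      gcongr
      exact hb t ht
  refine ⟨hupper, ?_, ?_⟩
  · rintro ⟨c₀, C', hc₀, hC', hb⟩
    have hx₁ := hupper.1 ⟨C', hC', fun t ht ↦ (hb t ht).2⟩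
    refine ⟨hx₁, exists_lower_indices_of_le_damped hr hα hσ hC hκ hy (hmem.1 hx₁)
      (c := (n : ℝ)⁻¹ * c₀) (by positivity) fun t ht ↦ ?_⟩
    calc _ = ENNReal.ofReal (n : ℝ)⁻¹ *
          ENNReal.ofReal (c₀ * (1 + t) ^ (-(σ - σ₁) / (2 * α))) := by
          rw [← ENNReal.ofReal_mul (by positivity), mul_assoc]
      _ ≤ ENNReal.ofReal (n : ℝ)⁻¹ *
          (ENNReal.ofReal n * weightedNorm r σ (blockNorm χ p (U t))) := by
          gcongr
          refine (hb t ht).1.trans ((besovNorm_le_weightedNorm χ σ p r (U t)).trans_eq ?_)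
          rw [ENNReal.ofReal_natCast]
      _ = _ := by
          rw [← mul_assoc, ← ENNReal.ofReal_mul (by positivity), inv_mul_cancel₀ hn0.ne',
            ENNReal.ofReal_one, one_mul]
  · rintro ⟨hx₁, c₀, M, j, hc₀, -, hj, hM, hcj⟩
    obtain ⟨C', hC', hb⟩ := hupper.2 hx₁
    obtain ⟨c', hc', hlow⟩ := exists_le_weightedNorm_damped hr hα hσ hC hxy hc₀ hj hM hcj
    exact ⟨c', C', hc', hC', fun t ht ↦
      ⟨(hlow t ht).trans (weightedNorm_le_besovNorm χ σ p hr (U t)), hb t ht⟩⟩
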